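/- Let $F$ be an algebraically closed field of characteristic zero (for instance $F=\mathbb C$). All fields $K$ below are finitely generated field extensions of $F$. The essential dimension of a finite extension $B/A$ is the least transcendence degree over $F$ of a subfield $F\subseteq A_0\subseteq A$ such that $B=A\cdot B_0$ for a subfield $A_0\subseteq B_0\subseteq B$ with $[B_0:A_0]=[B:A]$. The resolvent degree $\mathrm{RD}(K'/K)$ is the least $m$ such that $K'$ embeds over $K$ into the top of a tower of finite extensions of $K$ each step of which has essential dimension at most $m$. $\mathrm{RD}(n)$ denotes the resolvent degree of the extension of $F(a_1,\dots,a_n)$ generated by one root of the general polynomial $z^n+a_1z^{n-1}+\cdots+a_n$. A system $S$ of homogeneous polynomials over $K$ is of type $(d;\ell_d,\dots,\ell_1)$ if it consists of $\ell_j$ forms of degree $j$ for each $1\le j\le d$. A linear solution of $S$ over an extension $K'/K$ is a pair of linearly independent vectors $P_0,P_1$ over $K'$ all of whose $K'$-linear combinations are solutions of $S$. Let $[d;\ell_d,\dots,\ell_1]$ be the number of variables necessary to determine a linear solution of a system of type $(d;\ell_d,\dots,\ell_1)$: the least $N\in\mathbb Z_{\ge0}\cup\{\infty\}$ such that for every $n\ge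 N$ and every $K$, each system of type $(d;\ell_d,\dots,\ell_1)$ in $n$ variables over $K$ has a linear solution over some extension $K'/K$ with $\mathrm{RD}(K'/K)\le\mathrm{RD}(d)$. **Proposition (Sylvester's Formula of Obliteration).** Let $d\ge2$ and let $\ell_d,\dots,\ell_1\ge0$ be integers with $\ell_d\ge2$. Then $$[d;\ell_d,\dots,\ell_1]\ \le\ [d-1;\lambda_{d-1},\dots,\lambda_2,\lambda_1]+\ell_d\ =\ [d-1;\lambda_{d-1},\dots,\lambda_2,\lambda_1+\ell_d],$$ where for $1\le j\le d-1$ $$\lambda_{d-j}=\binom{\ell_d+j-1}{j}\frac{j\ell_d+1}{j+1}+\sum_{\nu=0}^{j-1}\binom{\ell_d+\nu-1}{\nu}\ell_{d-j+\nu}.$$ The same inequality and the same equality hold if $[d;\ell_d,\dots,\ell_1]$ is read instead as $r(\mathcal C)+1$, where $r(\mathcal C)$ is the minimal dimension bound of the polar cone $\mathcal C$ of $S$ at one of its solutions, that is, $r\bigl(d;\ \ell_d,\ \ell_d+\ell_{d-1},\ \dots,\ \sum_{j=1}^d\ell_j\bigr)+1$; here $r(d;m_d,\dots,m_1)$ is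 the least $r'\in\mathbb Z_{\ge1}\cup\{\infty\}$ such that for every $r\ge r'$ and every $K$, each intersection of hypersurfaces of type $(d;m_d,\dots,m_1)$ in $\mathbb P^r_K$ has a point over some extension $K'/K$ with $\mathrm{RD}(K'/K)\le\mathrm{RD}(d)$. -/

import Mathlib

open scoped BigOperators

universe u

namespace Obliteration

noncomputable section

/-! ### Resolvent degree (relative to a base field `F`) -/

/-- Essential dimension over `F` of an extension `A ≤ B` of subfields of `E`: the least transcendence
degree over `F` of a subfield `A₀` of `A` such that `B / A` descends to an extension `B₀ / A₀`, i.e.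
`B = A · B₀` and `[B₀ : A₀] = [B : A]`. (Used for finite extensions, where this says
`B = A ⊗[A₀] B₀`.) -/
def essDim {F E : Type u} [Field F] [Field E] [Algebra F E]
    (A B : IntermediateField F E) : ℕ∞ :=
  sInf {e : ℕ∞ | ∃ A₀ B₀ : IntermediateField F E,
    A₀ ≤ A ∧ A₀ ≤ B₀ ∧ A ⊔ B₀ = B ∧
    IntermediateField.relfinrank A₀ B₀ = IntermediateField.relfinrank A B ∧
    e = Cardinal.toENat (Algebra.trdeg F A₀)}

/-- `IsTower F K E m`: there is a tower of finite extensions `K = E₀ ⊆ E₁ ⊆ ⋯ ⊆ E_t = E` over `F`,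
each step of which has essential dimension at most `m`. -/
def IsTower (F K E : Type u) [Field F] [Field K] [Field E] [Algebra F K] [Algebra F E]
    [Algebra K E] [IsScalarTower F K E] (m : ℕ∞) : Prop :=
  ∃ (t : ℕ) (T : ℕ → IntermediateField F E),
    T 0 = (IsScalarTower.toAlgHom F K E).fieldRange ∧
    T t = ⊤ ∧
    ∀ i < t, T i ≤ T (i + 1) ∧
      IntermediateField.relfinrank (T i) (T (i + 1)) ≠ 0 ∧
      essDim (T i) (T (i + 1)) ≤ m

/-- The resolvent degree of `L / K` over `F`: the least `m` such that `L` embeds over `K` into the top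
of a tower of finite extensions of `K` with steps of essential dimension at most `m` (`⊤` if there
is no such tower). It is used for fields `L`; no field instance on `L` is needed to write it down,
since ring homomorphisms between fields are embeddings. -/
def resolventDegree (F K L : Type u) [Field F] [Field K] [Algebra F K] [CommRing L] [Algebra K L] :
    ℕ∞ :=
  sInf {m : ℕ∞ | ∃ (E : Type u) (_ : Field E) (_ : Algebra F E) (_ : Algebra K E)
    (_ : IsScalarTower F K E), IsTower F K E m ∧ Nonempty (L →ₐ[K] E)}

/-- The field `F(a₁, …, aₙ)` of rational functions. -/
abbrev GenericField (F : Type u) [Field F] (n : ℕ) : Type u :=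
  FractionRing (MvPolynomial (Fin n) F)

/-- The general polynomial `zⁿ + a₁ zⁿ⁻¹ + ⋯ + aₙ`; the variable `X i` plays the role of `a_{i+1}`. -/
def genericPoly (F : Type u) [Field F] (n : ℕ) : Polynomial (GenericField F n) :=
  Polynomial.X ^ n + ∑ i : Fin n,
    Polynomial.C (algebraMap (MvPolynomial (Fin n) F) (GenericField F n) (MvPolynomial.X i)) *
      Polynomial.X ^ (n - 1 - (i : ℕ))

/-- `RD(n)`: the resolvent degree of the general polynomial of degree `n`, i.e. of the extension
`F(a₁, …, aₙ)[z] / (zⁿ + a₁ zⁿ⁻¹ + ⋯ + aₙ)` of `F(a₁, …, aₙ)`. -/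
def RD (F : Type u) [Field F] (n : ℕ) : ℕ∞ :=
  resolventDegree F (GenericField F n) (AdjoinRoot (genericPoly F n))

/-! ### Systems of homogeneous polynomials -/

/-- A system of type `(d; ℓ_d, …, ℓ_1)` in `n` variables over `K`: for every `1 ≤ j ≤ d`, a list of
`ℓ j` homogeneous polynomials of degree `j`. -/
def IsSystem {K : Type u} [Field K] (n d : ℕ) (ℓ : ℕ → ℕ)
    (f : (j : ℕ) → Fin (ℓ j) → MvPolynomial (Fin n) K) : Prop :=
  ∀ j ∈ Finset.Icc 1 d, ∀ i, (f j i).IsHomogeneous j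

/-- The vector `P` with coordinates in an extension `K'` of `K` solves the system `f`. -/
def IsSolution {K K' : Type u} [Field K] [Field K'] [Algebra K K'] {n : ℕ} (d : ℕ) {ℓ : ℕ → ℕ}
    (f : (j : ℕ) → Fin (ℓ j) → MvPolynomial (Fin n) K) (P : Fin n → K') : Prop :=
  ∀ j ∈ Finset.Icc 1 d, ∀ i, MvPolynomial.aeval P (f j i) = 0

/-- Over every field `K` finitely generated over `F`, every system of type `(d; ℓ_d, …, ℓ_1)` in
`n` variables has a nonzero solution (a point of projective `(n-1)`-space) over an extension
`K' / K` with `RD(K' / K) ≤ RD(d)`. -/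
def CanDeterminePoint (F : Type u) [Field F] (d : ℕ) (ℓ : ℕ → ℕ) (n : ℕ) : Prop :=
  ∀ (K : Type u) [Field K] [Algebra F K], (⊤ : IntermediateField F K).FG →
    ∀ f : (j : ℕ) → Fin (ℓ j) → MvPolynomial (Fin n) K, IsSystem n d ℓ f →
      ∃ (K' : Type u) (_ : Field K') (_ : Algebra K K'), resolventDegree F K K' ≤ RD F d ∧
        ∃ P : Fin n → K', P ≠ 0 ∧ IsSolution d f P

/-- As `CanDeterminePoint`, for linear solutions: two linearly independent vectors `P₀`, `P₁` (two
distinct projective points) all of whose linear combinations solve the system. -/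
def CanDetermineLine (F : Type u) [Field F] (d : ℕ) (ℓ : ℕ → ℕ) (n : ℕ) : Prop :=
  ∀ (K : Type u) [Field K] [Algebra F K], (⊤ : IntermediateField F K).FG →
    ∀ f : (j : ℕ) → Fin (ℓ j) → MvPolynomial (Fin n) K, IsSystem n d ℓ f →
      ∃ (K' : Type u) (_ : Field K') (_ : Algebra K K'), resolventDegree F K K' ≤ RD F d ∧
        ∃ P₀ P₁ : Fin n → K', LinearIndependent K' ![P₀, P₁] ∧
          ∀ a b : K', IsSolution d f (a • P₀ + b • P₁)

/-- The minimal dimension bound `r(d; ℓ_d, …, ℓ_1)`: the least `r' ∈ ℤ_{≥ 1} ∪ {∞}` such that for all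
`r ≥ r'` a point of any intersection of hypersurfaces of type `(d; ℓ_d, …, ℓ_1)` in projective
`r`-space can be determined over an extension of resolvent degree at most `RD(d)`. -/
def minDimBound (F : Type u) [Field F] (d : ℕ) (ℓ : ℕ → ℕ) : ℕ∞ :=
  sInf {r' : ℕ∞ | 1 ≤ r' ∧ ∀ r : ℕ, r' ≤ r → CanDeterminePoint F d ℓ (r + 1)}

/-- The number of variables necessary to determine a linear solution of any system of type
`(d; ℓ_d, …, ℓ_1)` over an extension of resolvent degree at most `RD(d)`. -/
def numVarsLinear (F : Type u) [Field F] (d : ℕ) (ℓ : ℕ → ℕ) : ℕ∞ :=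
  sInf {N : ℕ∞ | ∀ n : ℕ, N ≤ n → CanDetermineLine F d ℓ n}

/-- The type of the polar cone (first emanant) at a point of a system of type `(d; ℓ_d, …, ℓ_1)`: a
form of degree `j` has exactly one polar in each of the degrees `1, …, j`. -/
def polarConeType (d : ℕ) (ℓ : ℕ → ℕ) (k : ℕ) : ℕ :=
  ∑ j ∈ Finset.Icc k d, ℓ j

/-- The minimal dimension bound of the polar cone, plus one: `r(𝒞(𝕍(S); P₀)) + 1` for a system `S` of
type `(d; ℓ_d, …, ℓ_1)` and a solution `P₀` of it. -/
def polarConeBound (F : Type u) [Field F] (d : ℕ) (ℓ : ℕ → ℕ) : ℕ∞ :=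
  minDimBound F d (polarConeType d ℓ) + 1

/-- The numbers `λ_k`, `1 ≤ k ≤ d - 1`. With `k = d - j` this is
`C(ℓ_d + j - 1, j) (j ℓ_d + 1) / (j + 1) + ∑_{ν < j} C(ℓ_d + ν - 1, ν) ℓ_{d - j + ν}`; the division is
exact, see `oblitCount_sub`. -/
def oblitCount (d : ℕ) (ℓ : ℕ → ℕ) (k : ℕ) : ℕ :=
  ((ℓ d + (d - k) - 1).choose (d - k) * ((d - k) * ℓ d + 1)) / ((d - k) + 1) +
    ∑ ν ∈ Finset.range (d - k), (ℓ d + ν - 1).choose ν * ℓ (k + ν)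

theorem oblitCount_sub (d : ℕ) (ℓ : ℕ → ℕ) (hℓ : 1 ≤ ℓ d) (j : ℕ) (hj : j ≤ d) :
    (oblitCount d ℓ (d - j) : ℚ) =
      ((ℓ d + j - 1).choose j : ℚ) * (((j : ℚ) * ℓ d + 1) / ((j : ℚ) + 1)) +
        ∑ ν ∈ Finset.range j, ((ℓ d + ν - 1).choose ν : ℚ) * ℓ (d - j + ν) := by
  obtain ⟨m, hm⟩ : ∃ m, ℓ d = m + 1 := ⟨ℓ d - 1, by omega⟩
  have h1 : d - (d - j) = j := by omega
  have h2 : m + 1 + j - 1 = m + j := by omega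
  have hdvd : (j + 1) ∣ (m + j).choose j * (j * (m + 1) + 1) := by
    have h := Nat.choose_succ_right_eq (m + j) j
    rw [Nat.add_sub_cancel] at h
    have e : (m + j).choose j * (j * (m + 1) + 1) + (m + j).choose (j + 1) * (j + 1) =
        (j + 1) * ((m + 1) * (m + j).choose j) := by
      rw [h]; ring
    exact (Nat.dvd_add_left (Dvd.intro_left _ rfl)).1 (e ▸ Dvd.intro _ rfl)
  have h3 : ((j : ℚ) + 1) ≠ 0 := by positivity
  unfold oblitCount
  rw [h1, hm, h2, Nat.cast_add, Nat.cast_div hdvd (by exact_mod_cast h3)]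
  push_cast
  ring

end

end Obliteration

/-! Put `m = RD F d`, and call a field over `F` closed if every polynomial whose coefficients lie in
the `F`-algebra generated by at most `m` elements of the field splits (`IsRDClosed`). A tower over
`K` with steps of essential dimension at most `m` embeds into every closed extension of `K`.
Conversely, finitely many elements of the closure of `K` already lie in such a tower. Determining a
point or a line within resolvent degree `m` is therefore the same as having one over every closed
field (`canDetermineFlat_iff`).

Closedness at level `RD F n`, with `n ≥ 2`, makes all polynomials of degree at most `n` split
(`IsRDClosed.splits_of_natDegree_le`). For algebraically independent roots this is the definition of
`RD F n`. Arbitrary distinct roots `θ_j` are replaced by `∑ b_i θ_j ^ i` with independent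
transcendentals `b_i`; these are algebraically independent by Vandermonde, and a specialization of
the `b_i` leads back. As a by-product, `RD` is monotone (`RD_mono`), so closed fields also have the
flats promised in degree `d - 1`.

Over a closed field two moves remain. A line solving all forms but one of degree `d` carries a point
solving that one too (`HasFlat.point_of_line`), and a point of the polar cone at a solution spans a
line of solutions with it, at the cost of one variable (`HasFlat.line_of_point`). Together they
remove one form of degree `d` and replace the lower counts by those of the polar cone. The numbers
`oblitCount` are invariant under this exchange (`oblitCount_step`), and equal the counts themselves
once no form of degree `d` is left (`oblitCount_of_zero`). Induction on `ℓ d` gives both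
inequalities. The equalities say that a linear form is worth exactly one variable. -/

namespace Obliteration

noncomputable section

/-! ### Forms: linear substitution, restriction to lines, polars. -/

section Forms

open MvPolynomial

variable {K : Type u} [Field K]

theorem eval_aeval_eq {n N : ℕ} (g : Fin N → MvPolynomial (Fin n) K) (P : Fin n → K)
    (f : MvPolynomial (Fin N) K) : eval P (aeval g f) = eval (fun i => eval P (g i)) f := by
  induction f using MvPolynomial.induction_on with
  | C a => simp only [aeval_C, eval_C, algebraMap_eq]
  | add p q hp hq => simp only [map_add, hp, hq]
  | mul_X p i hp => simp only [map_mul, hp, aeval_X, eval_X]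

theorem totalDegree_aeval_le {n N : ℕ} (g : Fin N → MvPolynomial (Fin n) K)
    (hg : ∀ i, (g i).totalDegree ≤ 1) (f : MvPolynomial (Fin N) K) :
    (aeval g f).totalDegree ≤ f.totalDegree := by
  rw [aeval_def, eval₂_eq]
  refine (totalDegree_finsetSum _ _).trans (Finset.sup_le fun s hs => ?_)
  refine (totalDegree_mul _ _).trans ?_
  rw [algebraMap_eq, totalDegree_C, zero_add]
  refine (totalDegree_finsetProd _ _).trans ?_
  refine le_trans (Finset.sum_le_sum fun i _ => ?_) (le_totalDegree hs)
  refine (totalDegree_pow _ _).trans ?_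
  simpa using Nat.mul_le_mul_left (s i) (hg i)

/-- Substitution of a linear map into polynomial functions. -/
def linSubst {n N : ℕ} (A : (Fin n → K) →ₗ[K] (Fin N → K)) :
    MvPolynomial (Fin N) K →ₐ[K] MvPolynomial (Fin n) K :=
  aeval fun i => ∑ j, C (A (Pi.single j 1) i) * X j

theorem eval_linSubst {n N : ℕ} (A : (Fin n → K) →ₗ[K] (Fin N → K)) (P : Fin n → K)
    (f : MvPolynomial (Fin N) K) : eval P (linSubst A f) = eval (A P) f := by
  have h : ∀ i, A P i = ∑ j, A (Pi.single j 1) i * P j := by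
    intro i
    conv_lhs => rw [LinearMap.pi_apply_eq_sum_univ A P]
    simp only [Finset.sum_apply, Pi.smul_apply, smul_eq_mul]
    refine Finset.sum_congr rfl fun j _ => ?_
    rw [mul_comm]
    refine congrArg (fun v => A v i * P j) (_root_.funext fun l => ?_)
    simp [Pi.single_apply, eq_comm]
  unfold linSubst
  rw [eval_aeval_eq]
  congr 2
  funext i
  simp [h]

theorem isHomogeneous_linSubst {n N : ℕ} (A : (Fin n → K) →ₗ[K] (Fin N → K))
    {f : MvPolynomial (Fin N) K} {j : ℕ} (hf : f.IsHomogeneous j) :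
    (linSubst A f).IsHomogeneous j := by
  have := hf.aeval (S := K) (n := 1) (fun i => ∑ l, C (A (Pi.single l 1) i) * X l)
    (fun i => IsHomogeneous.sum _ _ _ fun l _ => isHomogeneous_C_mul_X _ _)
  rwa [one_mul] at this

theorem eval_smul_of_isHomogeneous {n j : ℕ} {f : MvPolynomial (Fin n) K}
    (hf : f.IsHomogeneous j) (c : K) (P : Fin n → K) :
    eval (c • P) f = c ^ j * eval P f := by
  rw [eval_eq, eval_eq, Finset.mul_sum]
  refine Finset.sum_congr rfl fun s hs => ?_
  have h : ∑ i ∈ s.support, s i = j := by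
    rw [hf.degree_eq_sum_deg_support hs]
  simp only [Pi.smul_apply, smul_eq_mul, mul_pow, Finset.prod_mul_distrib]
  rw [Finset.prod_pow_eq_pow_sum, h]
  ring

/-- The restriction of a polynomial to the affine line `P + X • Q`. -/
def onLine {n : ℕ} (P Q : Fin n → K) (f : MvPolynomial (Fin n) K) : Polynomial K :=
  aeval (fun i => Polynomial.C (P i) + Polynomial.X * Polynomial.C (Q i)) f

theorem eval_onLine {n : ℕ} (P Q : Fin n → K) (f : MvPolynomial (Fin n) K) (t : K) :
    (onLine P Q f).eval t = eval (P + t • Q) f := by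
  unfold onLine
  induction f using MvPolynomial.induction_on with
  | C a => simp
  | add p q hp hq => simp only [map_add, Polynomial.eval_add, hp, hq]
  | mul_X p i hp =>
    simp only [map_mul, Polynomial.eval_mul, hp, aeval_X, eval_X]
    simp [mul_comm t]

theorem natDegree_onLine_le {n j : ℕ} (P Q : Fin n → K) {f : MvPolynomial (Fin n) K}
    (hf : f.IsHomogeneous j) : (onLine P Q f).natDegree ≤ j := by
  have := MvPolynomial.aeval_natDegree_le (m := j) (n := 1) f hf.totalDegree_le
    (fun i => Polynomial.C (P i) + Polynomial.X * Polynomial.C (Q i)) (fun i => by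
      refine (Polynomial.natDegree_add_le _ _).trans ?_
      simp only [Polynomial.natDegree_C, zero_le, sup_of_le_right]
      refine Polynomial.natDegree_mul_le.trans ?_
      simp)
  simpa [onLine] using this

/-- A form of positive degree that vanishes on `P + t • Q` for all `t` vanishes at `Q`. -/
theorem eval_eq_zero_of_line [Infinite K] {n j : ℕ} {f : MvPolynomial (Fin n) K}
    (hf : f.IsHomogeneous j) {P Q : Fin n → K} {c : K} (hj : 1 ≤ j)
    (h : ∀ t : K, eval (P + t • Q) f = c) : eval Q f = 0 := by
  -- Reversing the parameter: for `s ≠ 0`, `f (Q + sP) = s ^ j f (P + s⁻¹ Q) = c s ^ j`. At `s = 0`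
  -- the right side vanishes because `j ≥ 1`.
  have h1 : onLine Q P f = Polynomial.C c * Polynomial.X ^ j := by
    refine Polynomial.eq_of_infinite_eval_eq _ _
      (Set.Infinite.mono ?_ (Set.Finite.infinite_compl (Set.finite_singleton (0 : K))))
    intro s hs
    have hs0 : s ≠ 0 := hs
    simp only [Set.mem_ofPred_eq, eval_onLine, Polynomial.eval_mul, Polynomial.eval_C,
      Polynomial.eval_pow, Polynomial.eval_X]
    have : Q + s • P = s • (P + s⁻¹ • Q) := by
      rw [smul_add, smul_smul, mul_inv_cancel₀ hs0, one_smul, add_comm]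
    rw [this, eval_smul_of_isHomogeneous hf, h, mul_comm]
  have h2 := congrArg (Polynomial.eval 0) h1
  rw [eval_onLine] at h2
  simpa [show j ≠ 0 by omega] using h2

/-- The polars of `f` at `P`: the homogeneous components of `x ↦ f (P + x)`. -/
def polar {n : ℕ} (P : Fin n → K) (k : ℕ) (f : MvPolynomial (Fin n) K) :
    MvPolynomial (Fin n) K :=
  homogeneousComponent k (aeval (fun i => C (P i) + X i) f)

theorem isHomogeneous_polar {n : ℕ} (P : Fin n → K) (k : ℕ) (f : MvPolynomial (Fin n) K) :
    (polar P k f).IsHomogeneous k :=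
  homogeneousComponent_isHomogeneous _ _

/-- Taylor expansion at `P`: the shifted polynomial has degree at most `j`, so its homogeneous
components stop there. -/
theorem eval_add_eq_sum_polar {n j : ℕ} (P Q : Fin n → K) {f : MvPolynomial (Fin n) K}
    (hf : f.IsHomogeneous j) :
    eval (P + Q) f = ∑ k ∈ Finset.range (j + 1), eval Q (polar P k f) := by
  set g : MvPolynomial (Fin n) K := aeval (fun i => C (P i) + X i) f with hg
  have h1 : eval Q g = eval (P + Q) f := by
    rw [hg, eval_aeval_eq]
    congr 2
    funext i
    simp
  have h2 : g.totalDegree ≤ j := by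
    refine (totalDegree_aeval_le _ (fun i => ?_) f).trans hf.totalDegree_le
    refine (totalDegree_add _ _).trans ?_
    simp
  rw [← h1]
  conv_lhs => rw [← sum_homogeneousComponent g]
  rw [map_sum]
  refine Finset.sum_subset (by simpa using h2) fun k _ hk => ?_
  rw [homogeneousComponent_eq_zero _ _ (by simpa using hk), map_zero]

end Forms

/-! ### Subspaces of solutions, and the two moves between points and lines. -/

section Flats

open MvPolynomial

variable (K : Type u) [Field K]

/-- Every family of at most `ℓ j` forms of degree `j`, for `1 ≤ j ≤ d`, in `n` variables over `K`
vanishes on a `k`-dimensional subspace of `Kⁿ`. -/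
def HasFlat (k d : ℕ) (ℓ : ℕ → ℕ) (n : ℕ) : Prop :=
  ∀ S : ℕ → Finset (MvPolynomial (Fin n) K),
    (∀ j ∈ Finset.Icc 1 d, (S j).card ≤ ℓ j ∧ ∀ f ∈ S j, f.IsHomogeneous j) →
    ∃ W : Submodule K (Fin n → K), Module.finrank K W = k ∧
      ∀ P ∈ W, ∀ j ∈ Finset.Icc 1 d, ∀ f ∈ S j, eval P f = 0

variable {K}

theorem HasFlat.mono {k d n : ℕ} {ℓ ℓ' : ℕ → ℕ} (h : HasFlat K k d ℓ' n)
    (hl : ∀ j ∈ Finset.Icc 1 d, ℓ j ≤ ℓ' j) : HasFlat K k d ℓ n := fun S hS =>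
  h S fun j hj => ⟨(hS j hj).1.trans (hl j hj), (hS j hj).2⟩

theorem HasFlat.of_zero {k d n : ℕ} {ℓ : ℕ → ℕ} (h : HasFlat K k (d - 1) ℓ n) (h0 : ℓ d = 0) :
    HasFlat K k d ℓ n := by
  intro S hS
  obtain ⟨W, hW, hP⟩ := h S fun j hj => hS j (by simp only [Finset.mem_Icc] at *; omega)
  refine ⟨W, hW, fun P hPW j hj f hf => ?_⟩
  rcases eq_or_ne j d with rfl | hjd
  · have := (hS j hj).1
    rw [h0, Nat.le_zero, Finset.card_eq_zero] at this
    simp [this] at hf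
  · exact hP P hPW j (by simp only [Finset.mem_Icc] at *; omega) f hf

/-- Flats inside the image of an injective linear map. -/
theorem HasFlat.exists_le_range {k d n N : ℕ} {ℓ : ℕ → ℕ} (h : HasFlat K k d ℓ n)
    (A : (Fin n → K) →ₗ[K] (Fin N → K)) (hA : Function.Injective A)
    (S : ℕ → Finset (MvPolynomial (Fin N) K))
    (hS : ∀ j ∈ Finset.Icc 1 d, (S j).card ≤ ℓ j ∧ ∀ f ∈ S j, f.IsHomogeneous j) :
    ∃ W : Submodule K (Fin N → K), W ≤ LinearMap.range A ∧ Module.finrank K W = k ∧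
      ∀ P ∈ W, ∀ j ∈ Finset.Icc 1 d, ∀ f ∈ S j, eval P f = 0 := by
  classical
  obtain ⟨W, hW, hP⟩ := h (fun j => (S j).image (linSubst A)) fun j hj =>
    ⟨Finset.card_image_le.trans (hS j hj).1, fun f hf => by
      obtain ⟨g, hg, rfl⟩ := Finset.mem_image.1 hf
      exact isHomogeneous_linSubst A ((hS j hj).2 g hg)⟩
  refine ⟨W.map A, LinearMap.map_le_range, ?_, ?_⟩
  · rw [← hW]
    exact (Submodule.equivMapOfInjective A hA W).finrank_eq.symm
  · rintro _ ⟨P, hPW, rfl⟩ j hj f hf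
    rw [← eval_linSubst]
    exact hP P hPW j hj _ (Finset.mem_image_of_mem _ hf)

/-- A point lies on a line on which one form of the top degree was left out. -/
theorem HasFlat.point_of_line [Infinite K] {d n : ℕ} {ℓ : ℕ → ℕ} (hd : 1 ≤ d)
    (hK : ∀ p : Polynomial K, p.natDegree ≤ d → p.Splits)
    (h : HasFlat K 2 d (Function.update ℓ d (ℓ d - 1)) n) : HasFlat K 1 d ℓ n := by
  classical
  intro S hS
  have hdd : d ∈ Finset.Icc 1 d := by simp [hd]
  have sub (S' : ℕ → Finset (MvPolynomial (Fin n) K)) (hS' : ∀ j ∈ Finset.Icc 1 d,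
      (S' j).card ≤ Function.update ℓ d (ℓ d - 1) j ∧ ∀ f ∈ S' j, f.IsHomogeneous j) :
      ∃ P₀ P₁ : Fin n → K, LinearIndependent K ![P₀, P₁] ∧ ∀ P ∈ Submodule.span K {P₀, P₁},
        ∀ j ∈ Finset.Icc 1 d, ∀ f ∈ S' j, eval P f = 0 := by
    obtain ⟨W, hW, hP⟩ := h S' hS'
    let b := Module.finBasisOfFinrankEq K W hW
    refine ⟨b 0, b 1, ?_, fun P hPW => hP P ?_⟩
    · have := b.linearIndependent.map' W.subtype (Submodule.ker_subtype W)
      have e : W.subtype ∘ b = ![(b 0 : Fin n → K), b 1] := by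
        funext i
        fin_cases i <;> rfl
      rwa [e] at this
    · refine Submodule.span_le.2 ?_ hPW
      rintro x (rfl | rfl)
      exacts [(b 0).2, (b 1).2]
  suffices ∃ P : Fin n → K, P ≠ 0 ∧ ∀ j ∈ Finset.Icc 1 d, ∀ f ∈ S j, eval P f = 0 by
    obtain ⟨P, hP0, hP⟩ := this
    refine ⟨Submodule.span K {P}, finrank_span_singleton hP0, fun Q hQ j hj f hf => ?_⟩
    obtain ⟨c, rfl⟩ := Submodule.mem_span_singleton.1 hQ
    rw [eval_smul_of_isHomogeneous ((hS j hj).2 f hf), hP j hj f hf, mul_zero]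
  rcases (S d).eq_empty_or_nonempty with hE | ⟨f, hf⟩
  -- With no form of degree `d` there is nothing to leave out, and any point of the line will do.
  · obtain ⟨P₀, P₁, hli, hP⟩ := sub S fun j hj => ⟨by
      rcases eq_or_ne j d with rfl | hjd
      · simp [hE]
      · simpa [hjd] using (hS j hj).1, (hS j hj).2⟩
    exact ⟨P₀, hli.ne_zero 0, hP P₀ (Submodule.subset_span (by simp))⟩
  · obtain ⟨P₀, P₁, hli, hP⟩ := sub (Function.update S d ((S d).erase f)) fun j hj => by
      rcases eq_or_ne j d with rfl | hjd
      · have := (hS j hj).1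
        simp only [Function.update_self, Finset.card_erase_of_mem hf]
        exact ⟨by omega, fun g hg => (hS j hj).2 g (Finset.mem_of_mem_erase hg)⟩
      · simpa [hjd] using hS j hj
    have key : ∃ P ∈ Submodule.span K {P₀, P₁}, P ≠ 0 ∧ eval P f = 0 := by
      by_cases h1 : eval P₁ f = 0
      · exact ⟨P₁, Submodule.subset_span (by simp), hli.ne_zero 1, h1⟩
      -- If `f` were constant along `P₀ + t P₁`, it would vanish at the point at infinity `P₁`,
      -- which is excluded in this case.
      have hdeg : (onLine P₀ P₁ f).degree ≠ 0 := by
        intro h0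
        refine h1 (eval_eq_zero_of_line ((hS d hdd).2 f hf) (P := P₀) hd
          (c := (onLine P₀ P₁ f).coeff 0) fun t => ?_)
        rw [← eval_onLine, Polynomial.eq_C_of_degree_eq_zero h0]
        simp
      obtain ⟨t, ht⟩ := (hK _ (natDegree_onLine_le P₀ P₁ ((hS d hdd).2 f hf))).exists_eval_eq_zero
        hdeg
      rw [eval_onLine] at ht
      refine ⟨P₀ + t • P₁, Submodule.mem_span_pair.2 ⟨1, t, by simp⟩, fun h0 => ?_, ht⟩
      have := LinearIndependent.pair_iff.1 hli 1 t (by simpa using h0)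
      exact one_ne_zero this.1
    obtain ⟨P, hPW, hP0, hPf⟩ := key
    refine ⟨P, hP0, fun j hj g hg => ?_⟩
    by_cases hgf : j = d ∧ g = f
    · rw [hgf.2, hPf]
    · refine hP P hPW j hj g ?_
      rcases eq_or_ne j d with rfl | hjd
      · simpa using ⟨fun e => hgf ⟨rfl, e⟩, hg⟩
      · simpa [hjd] using hg

theorem polarConeType_top (d : ℕ) (ℓ : ℕ → ℕ) : polarConeType d ℓ d = ℓ d := by
  simp [polarConeType]

theorem le_polarConeType {d j : ℕ} (ℓ : ℕ → ℕ) (hj : j ≤ d) : ℓ j ≤ polarConeType d ℓ j :=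
  Finset.single_le_sum (f := ℓ) (fun _ _ => Nat.zero_le _) (by simp [hj])

/-- A solution of the polar cone at a solution spans a linear solution with it. -/
theorem HasFlat.line_of_point [Infinite K] {d n : ℕ} {ℓ : ℕ → ℕ}
    (h : HasFlat K 1 d (polarConeType d ℓ) n) : HasFlat K 2 d ℓ (n + 1) := by
  classical
  intro S hS
  have pick (W : Submodule K (Fin (n + 1) → K)) (hW : Module.finrank K W = 1) :
      ∃ P ∈ W, P ≠ 0 := by
    have : Nontrivial W := Module.nontrivial_of_finrank_pos (R := K) (by omega)
    obtain ⟨P, hP⟩ := exists_ne (0 : W)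
    exact ⟨P, P.2, by simpa using hP⟩
  have insA (i : Fin (n + 1)) : ∃ A : (Fin n → K) →ₗ[K] (Fin (n + 1) → K),
      Function.Injective A ∧ ∀ P, A P i = 0 := by
    refine ⟨{ toFun := fun P => i.insertNth 0 P
              map_add' := fun P Q => ?_
              map_smul' := fun c P => ?_ }, fun P Q hPQ => ?_, fun P => ?_⟩
    · rw [← Fin.insertNth_add, add_zero]
    · funext l
      refine Fin.succAboveCases i ?_ (fun m => ?_) l <;> simp
    · funext m
      have := congrFun hPQ (i.succAbove m)
      simpa using this
    · simp
  -- The first point may lie in any coordinate hyperplane; `x₀ = 0` only brings the number of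
  -- variables down to `n`.
  obtain ⟨A, hA, -⟩ := insA 0
  obtain ⟨W₀, -, hW₀, hP₀⟩ := (h.mono (ℓ := ℓ) fun j hj =>
    le_polarConeType ℓ (Finset.mem_Icc.1 hj).2).exists_le_range A hA S hS
  obtain ⟨P₀, hP₀W, hP₀0⟩ := pick W₀ hW₀
  -- The second point is sought in a hyperplane `x_i = 0` that misses `P₀`; this forces linear
  -- independence and is what the extra variable pays for.
  obtain ⟨i, hi⟩ := Function.ne_iff.1 hP₀0
  rw [Pi.zero_apply] at hi
  obtain ⟨B, hB, hBi⟩ := insA i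
  obtain ⟨W₁, hW₁r, hW₁, hP₁⟩ := h.exists_le_range B hB
    (fun k => (Finset.Icc k d).biUnion fun j => (S j).image (polar P₀ k)) fun k hk => by
      refine ⟨Finset.card_biUnion_le.trans (Finset.sum_le_sum fun j hj => ?_), fun f hf => ?_⟩
      · exact Finset.card_image_le.trans
          (hS j (by simp only [Finset.mem_Icc] at *; omega)).1
      · simp only [Finset.mem_biUnion, Finset.mem_image] at hf
        obtain ⟨j, -, g, -, rfl⟩ := hf
        exact isHomogeneous_polar _ _ _
  obtain ⟨P₁, hP₁W, hP₁0⟩ := pick W₁ hW₁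
  have hi₁ : P₁ i = 0 := by
    obtain ⟨Q, rfl⟩ := hW₁r hP₁W
    exact hBi Q
  have hli : LinearIndependent K ![P₀, P₁] := by
    refine LinearIndependent.pair_iff.2 fun s t hst => ?_
    have hs : s = 0 := by
      have := congrFun hst i
      simpa [hi₁, hi] using this
    refine ⟨hs, ?_⟩
    rw [hs, zero_smul, zero_add] at hst
    exact (smul_eq_zero.1 hst).resolve_right hP₁0
  -- In the expansion at `P₀` the polars of degrees `1, …, j` vanish at `P₁` by choice, and the
  -- polar of degree `0` is the constant `f P₀ = 0`.
  have hadd : ∀ t : K, ∀ j ∈ Finset.Icc 1 d, ∀ f ∈ S j, eval (P₀ + t • P₁) f = 0 := by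
    intro t j hj f hf
    have hz := eval_add_eq_sum_polar P₀ (0 : Fin (n + 1) → K) ((hS j hj).2 f hf)
    rw [eval_add_eq_sum_polar P₀ _ ((hS j hj).2 f hf), Finset.sum_range_succ']
    rw [add_zero, hP₀ P₀ hP₀W j hj f hf, Finset.sum_range_succ'] at hz
    rw [Finset.sum_eq_zero, zero_add]
    · rw [Finset.sum_eq_zero, zero_add] at hz
      · rw [hz, eval_smul_of_isHomogeneous (isHomogeneous_polar _ _ _)]
        rw [← zero_smul K P₁, eval_smul_of_isHomogeneous (isHomogeneous_polar _ _ _)]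
        simp
      · intro k _
        rw [← zero_smul K P₁, eval_smul_of_isHomogeneous (isHomogeneous_polar _ _ _)]
        simp
    · intro k hk
      rw [Finset.mem_range] at hk
      rw [Finset.mem_Icc] at hj
      rw [eval_smul_of_isHomogeneous (isHomogeneous_polar _ _ _),
        hP₁ P₁ hP₁W (k + 1) (by simp; omega) _ (Finset.mem_biUnion.2 ⟨j, by simp; omega,
          Finset.mem_image_of_mem _ hf⟩), mul_zero]
  refine ⟨Submodule.span K (Set.range ![P₀, P₁]), by
    rw [finrank_span_eq_card hli]; simp, fun P hP j hj f hf => ?_⟩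
  rw [Matrix.range_cons_cons_empty] at hP
  obtain ⟨a, b, rfl⟩ := Submodule.mem_span_pair.1 hP
  -- Up to scaling, the line is the affine part `P₀ + t P₁` together with `P₁`, where vanishing
  -- follows from `eval_eq_zero_of_line`.
  by_cases ha : a = 0
  · have := eval_eq_zero_of_line ((hS j hj).2 f hf) (Finset.mem_Icc.1 hj).1
      fun t => hadd t j hj f hf
    rw [ha, zero_smul, zero_add, eval_smul_of_isHomogeneous ((hS j hj).2 f hf), this, mul_zero]
  · have : a • P₀ + b • P₁ = a • (P₀ + (a⁻¹ * b) • P₁) := by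
      rw [smul_add, smul_smul, mul_inv_cancel_left₀ ha]
    rw [this, eval_smul_of_isHomogeneous ((hS j hj).2 f hf), hadd _ j hj f hf, mul_zero]

end Flats

/-! ### Trading linear forms for variables. -/

section LinearForms

open MvPolynomial

variable {K : Type u} [Field K]

theorem eval_add_of_isHomogeneous_one {n : ℕ} {f : MvPolynomial (Fin n) K}
    (hf : f.IsHomogeneous 1) (P Q : Fin n → K) :
    eval (P + Q) f = eval P f + eval Q f := by
  have h : f ∈ Submodule.span K (Set.range (X : Fin n → MvPolynomial (Fin n) K)) := by
    rwa [← homogeneousSubmodule_one_eq_span_X]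
  clear hf
  induction h using Submodule.span_induction with
  | mem x hx => obtain ⟨i, rfl⟩ := hx; simp
  | zero => simp
  | add x y _ _ hx hy => rw [map_add, map_add, map_add, hx, hy]; ring
  | smul a x _ hx => simp only [smul_eval, hx, mul_add]

/-- The common kernel of `m` linear forms in `n + m` variables has dimension at least `n`, so the
remaining system can be solved inside it. -/
theorem HasFlat.add_linear {k d n : ℕ} {ℓ : ℕ → ℕ} (hd : 1 ≤ d) (h : HasFlat K k d ℓ n) (m : ℕ) :
    HasFlat K k d (Function.update ℓ 1 (ℓ 1 + m)) (n + m) := by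
  classical
  intro S hS
  have h1 := hS 1 (by simp [hd])
  rw [Function.update_self] at h1
  -- The minimum covers systems with fewer than `m` linear forms; in either case at most `ℓ 1` of
  -- them remain outside `U`.
  obtain ⟨U, hUS, hU⟩ := Finset.exists_subset_card_eq (min_le_right m (S 1).card)
  let L : (Fin (n + m) → K) →ₗ[K] (U → K) :=
    { toFun := fun P f => eval P f.1
      map_add' := fun P Q => _root_.funext fun f =>
        eval_add_of_isHomogeneous_one (h1.2 _ (hUS f.2)) P Q
      map_smul' := fun c P => _root_.funext fun f => by
        simp [eval_smul_of_isHomogeneous (h1.2 _ (hUS f.2))] }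
  have hker : n ≤ Module.finrank K (LinearMap.ker L) := by
    have e1 := L.finrank_range_add_finrank_ker
    have e2 := (LinearMap.range L).finrank_le
    simp only [Module.finrank_fintype_fun_eq_card, Fintype.card_coe, Fintype.card_fin] at e1 e2
    omega
  obtain ⟨v, hv⟩ := exists_linearIndependent_of_le_finrank hker
  let A : (Fin n → K) →ₗ[K] (Fin (n + m) → K) :=
    (LinearMap.ker L).subtype ∘ₗ Fintype.linearCombination K v
  have hA : Function.Injective A :=
    Subtype.val_injective.comp (linearIndependent_iff_injective_fintypeLinearCombination.1 hv)
  obtain ⟨W, hWr, hW, hP⟩ := h.exists_le_range A hA (Function.update S 1 (S 1 \ U)) fun j hj => by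
    rcases eq_or_ne j 1 with rfl | hj1
    · rw [Function.update_self, Finset.card_sdiff_of_subset hUS]
      exact ⟨by omega, fun f hf => h1.2 f (Finset.sdiff_subset hf)⟩
    · simpa [hj1] using hS j hj
  refine ⟨W, hW, fun P hPW j hj f hf => ?_⟩
  by_cases hfU : j = 1 ∧ f ∈ U
  · obtain ⟨Q, rfl⟩ := hWr hPW
    exact congrFun (LinearMap.mem_ker.1 (Fintype.linearCombination K v Q).2) ⟨f, hfU.2⟩
  · refine hP P hPW j hj f ?_
    rcases eq_or_ne j 1 with rfl | hj1
    · simpa using ⟨hf, fun e => hfU ⟨rfl, e⟩⟩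
    · simpa [hj1] using hf

/-- Add `m` dummy variables together with the linear forms that set them to zero; forgetting these
coordinates is injective on the resulting flat. -/
theorem HasFlat.of_add_linear {k d n m : ℕ} {ℓ : ℕ → ℕ} (hd : 1 ≤ d)
    (h : HasFlat K k d (Function.update ℓ 1 (ℓ 1 + m)) (n + m)) : HasFlat K k d ℓ n := by
  classical
  intro S hS
  obtain ⟨W, hW, hP⟩ := h (fun j => (S j).image (rename (Fin.castAdd m)) ∪
      if j = 1 then Finset.univ.image fun i : Fin m => X (Fin.natAdd n i) else ∅) fun j hj => by
    constructor
    · refine (Finset.card_union_le _ _).trans ?_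
      have h0 := Finset.card_image_le (s := S j) (f := rename (R := K) (Fin.castAdd (n := n) m))
      have h2 := Finset.card_image_le (s := Finset.univ)
        (f := fun i : Fin m => (X (Fin.natAdd n i) : MvPolynomial (Fin (n + m)) K))
      have h3 := (hS j hj).1
      rw [Finset.card_fin] at h2
      rcases eq_or_ne j 1 with rfl | hj1
      · simp only [if_true, Function.update_self]
        omega
      · simp only [if_neg hj1, Function.update_of_ne hj1, Finset.card_empty]
        omega
    · intro f hf
      rcases Finset.mem_union.1 hf with hf | hf
      · obtain ⟨g, hg, rfl⟩ := Finset.mem_image.1 hf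
        exact ((hS j hj).2 g hg).rename_isHomogeneous
      · split_ifs at hf with hj1
        · obtain ⟨i, -, rfl⟩ := Finset.mem_image.1 hf
          rw [hj1]
          exact isHomogeneous_X _ _
        · simp at hf
  let π : (Fin (n + m) → K) →ₗ[K] (Fin n → K) := LinearMap.funLeft K K (Fin.castAdd m)
  have hz : ∀ P ∈ W, ∀ i : Fin m, P (Fin.natAdd n i) = 0 := fun P hPW i => by
    have := hP P hPW 1 (by simp [hd]) (X (Fin.natAdd n i)) (by simp)
    rwa [eval_X] at this
  have hinj : Function.Injective (π.domRestrict W) := by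
    rw [← LinearMap.ker_eq_bot, LinearMap.ker_eq_bot']
    rintro ⟨P, hPW⟩ h0
    refine Subtype.ext (_root_.funext fun i => ?_)
    refine Fin.addCases (fun i => ?_) (fun i => hz P hPW i) i
    exact congrFun h0 i
  refine ⟨W.map π, ?_, ?_⟩
  · rw [← LinearMap.range_domRestrict, LinearMap.finrank_range_of_inj hinj, hW]
  · rintro _ ⟨P, hPW, rfl⟩ j hj f hf
    have := hP P hPW j hj (rename (Fin.castAdd m) f)
      (Finset.mem_union_left _ (Finset.mem_image_of_mem _ hf))
    rwa [eval_rename] at this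

end LinearForms

/-! ### The binomial identities behind `oblitCount`. -/

section Counting

open MvPolynomial

/-- Hockey-stick identity. The truncated subtraction at `m = ν = 0` is harmless because the lower
index is `0` there. -/
theorem sum_choose_diag (m μ : ℕ) :
    ∑ ν ∈ Finset.range (μ + 1), (m + ν - 1).choose ν = (m + μ).choose μ := by
  induction μ with
  | zero => simp
  | succ μ ih =>
    rw [Finset.sum_range_succ, ih, show m + (μ + 1) - 1 = m + μ by omega, ← Nat.add_assoc,
      Nat.choose_succ_succ]

/-- Rewrites the fractional leading term of `oblitCount` without division, so that Pascal's rule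
applies. It rests on `C(q+j, j+2) (j+2) = C(q+j, j+1) (q-1)` for `q ≥ 1`; for `q = 0` every binomial
involved is zero. -/
theorem choose_mul_div_add_choose (q j : ℕ) :
    (q + j).choose (j + 1) * ((j + 1) * q + 1) / (j + 2) + (q + j).choose (j + 2) =
      q * (q + j).choose (j + 1) := by
  have h := Nat.choose_succ_right_eq (q + j) (j + 1)
  have e : (q + j).choose (j + 1) * ((j + 1) * q + 1) + (q + j).choose (j + 2) * (j + 2) =
      (q * (q + j).choose (j + 1)) * (j + 2) := by
    rw [h]
    rcases q with _ | q
    · simp [Nat.choose_succ_self]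
    · rw [show q + 1 + j - (j + 1) = q by omega]
      ring
  rw [← Nat.add_mul_div_right _ _ (by omega : 0 < j + 2), e, Nat.mul_div_cancel _ (by omega)]

/-- End of the induction: `C(ν - 1, ν) = 0` for `ν ≥ 1`, which kills the leading term and all
summands but `ν = 0`. -/
theorem oblitCount_of_zero {d k : ℕ} {ℓ : ℕ → ℕ} (h : ℓ d = 0) (hk : k < d) :
    oblitCount d ℓ k = ℓ k := by
  obtain ⟨j, rfl⟩ : ∃ j, d = k + (j + 1) := ⟨d - k - 1, by omega⟩
  unfold oblitCount
  rw [Nat.add_sub_cancel_left, h, Finset.sum_range_succ', Finset.sum_eq_zero]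
  · simp
  · intro ν _
    simp

/-- The invariance that explains the shape of `oblitCount`. Passing to the polar cone turns each
count into a tail sum; after regrouping, the hockey-stick identity turns the coefficients for `ℓ d -
1` into those for `ℓ d`. The contributions of `ℓ d` itself account for the change of the leading
term. -/
theorem oblitCount_step {d k : ℕ} {ℓ : ℕ → ℕ} (h : ℓ d ≠ 0) (hk : k < d) :
    oblitCount d (Function.update (polarConeType d ℓ) d (ℓ d - 1)) k = oblitCount d ℓ k := by
  obtain ⟨j, rfl⟩ : ∃ j, d = k + (j + 1) := ⟨d - k - 1, by omega⟩
  obtain ⟨m, hm⟩ := Nat.exists_eq_succ_of_ne_zero h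
  unfold oblitCount
  rw [Nat.add_sub_cancel_left, Function.update_self, hm, Nat.succ_sub_one]
  -- Each tail sum is split into the counts below degree `d` and its last term `ℓ d = m + 1`.
  have h1 : ∀ ν ∈ Finset.range (j + 1),
      (m + ν - 1).choose ν * Function.update (polarConeType (k + (j + 1)) ℓ) (k + (j + 1)) m (k + ν) =
        ∑ i ∈ Finset.range (j + 1 - ν), (m + ν - 1).choose ν * ℓ (k + (ν + i)) +
          (m + ν - 1).choose ν * (m + 1) := by
    intro ν hν
    rw [Finset.mem_range] at hν
    rw [Function.update_of_ne (by omega), polarConeType, ← Finset.mul_sum, ← mul_add,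
      ← Finset.Ico_succ_right_eq_Icc, Order.succ_eq_add_one, Finset.sum_Ico_eq_sum_range,
      show k + (j + 1) + 1 - (k + ν) = j + 1 - ν + 1 by omega, Finset.sum_range_succ,
      show k + ν + (j + 1 - ν) = k + (j + 1) by omega, hm]
    simp only [add_assoc]
  rw [Finset.sum_congr rfl h1, Finset.sum_add_distrib, ← Finset.sum_mul, sum_choose_diag,
    ← Finset.sum_range_diag_flip (j + 1) fun ν i => (m + ν - 1).choose ν * ℓ (k + (ν + i))]
  have h2 : ∀ μ ∈ Finset.range (j + 1),
      ∑ ν ∈ Finset.range (μ + 1), (m + ν - 1).choose ν * ℓ (k + (ν + (μ - ν))) =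
        (m.succ + μ - 1).choose μ * ℓ (k + μ) := by
    intro μ _
    rw [show m.succ + μ - 1 = m + μ by omega, ← sum_choose_diag, Finset.sum_mul]
    refine Finset.sum_congr rfl fun ν hν => ?_
    rw [Finset.mem_range] at hν
    rw [show ν + (μ - ν) = μ by omega]
  rw [Finset.sum_congr rfl h2]
  -- What is left compares the leading terms for `m` and `m + 1`; their difference is `(m + 1) C(m +
  -- j, j)`, by Pascal.
  have e1 := choose_mul_div_add_choose m j
  have e2 := choose_mul_div_add_choose (m + 1) j
  rw [show m + (j + 1) - 1 = m + j by omega, show m.succ + (j + 1) - 1 = m + 1 + j by omega]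
  rw [Nat.succ_eq_add_one]
  have p1 : (m + 1 + j).choose (j + 2) = (m + j).choose (j + 1) + (m + j).choose (j + 2) := by
    rw [show m + 1 + j = m + j + 1 by omega, Nat.choose_succ_succ]
  have p2 : (m + 1 + j).choose (j + 1) = (m + j).choose j + (m + j).choose (j + 1) := by
    rw [show m + 1 + j = m + j + 1 by omega, Nat.choose_succ_succ]
  rw [show j + 1 + 1 = j + 2 by omega]
  generalize (m + 1 + j).choose (j + 1) * ((j + 1) * (m + 1) + 1) / (j + 2) = y at e2 ⊢
  rw [p1, p2] at e2
  linarith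

end Counting

/-! ### Removing all forms of top degree over a closed field. -/

section Obliterate

variable {K : Type u} [Field K]

theorem polarConeType_congr {d k : ℕ} {ℓ ℓ' : ℕ → ℕ} (hk : 1 ≤ k)
    (h : ∀ j ∈ Finset.Icc 1 d, ℓ j = ℓ' j) : polarConeType d ℓ k = polarConeType d ℓ' k :=
  Finset.sum_congr rfl fun j hj => h j (by simp only [Finset.mem_Icc] at *; omega)

/-- A linear form contributes one polar, of degree `1`, so adding linear forms to the system adds
equally many to the cone. Degree `0` is excluded because the sum there also counts the linear forms.
-/
theorem polarConeType_update (d m : ℕ) (hd : 1 ≤ d) (ℓ : ℕ → ℕ) {k : ℕ} (hk : 1 ≤ k) :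
    polarConeType d (Function.update ℓ 1 (ℓ 1 + m)) k =
      Function.update (polarConeType d ℓ) 1 (polarConeType d ℓ 1 + m) k := by
  unfold polarConeType
  rcases eq_or_ne k 1 with rfl | hk1
  · rw [Function.update_self, ← Finset.add_sum_Ioc_eq_sum_Icc hd,
      ← Finset.add_sum_Ioc_eq_sum_Icc hd, Function.update_self,
      Finset.sum_congr rfl fun j hj => Function.update_of_ne
        (by rw [Finset.mem_Ioc] at hj; omega : j ≠ 1) (ℓ 1 + m) ℓ]
    ring
  · rw [Function.update_of_ne hk1]
    exact Finset.sum_congr rfl fun j hj => Function.update_of_ne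
      (by rw [Finset.mem_Icc] at hj; omega : j ≠ 1) _ _

theorem polarConeType_pred {d k : ℕ} {ℓ : ℕ → ℕ} (h : ℓ d = 0) :
    polarConeType d ℓ k = polarConeType (d - 1) ℓ k := by
  refine (Finset.sum_subset (Finset.Icc_subset_Icc_right (Nat.sub_le d 1)) fun j hj hj' => ?_).symm
  have : j = d := by simp only [Finset.mem_Icc] at *; omega
  rw [this, h]

/-- Each induction step applies the two moves once: one form of degree `d` and one variable
disappear, while `oblitCount` stays fixed. -/
theorem HasFlat.line_obliterate [Infinite K] {d : ℕ} (hd : 1 ≤ d)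
    (hK : ∀ p : Polynomial K, p.natDegree ≤ d → p.Splits) {ℓ : ℕ → ℕ} {n : ℕ}
    (h : HasFlat K 2 (d - 1) (oblitCount d ℓ) n) : HasFlat K 2 d ℓ (n + ℓ d) := by
  generalize hq : ℓ d = q
  induction q generalizing ℓ with
  | zero =>
    refine (h.mono fun j hj => (oblitCount_of_zero hq ?_).ge).of_zero hq
    rw [Finset.mem_Icc] at hj
    omega
  | succ q ih =>
    refine HasFlat.line_of_point (HasFlat.point_of_line hd hK ?_)
    rw [polarConeType_top]
    refine ih (h.mono fun j hj => (oblitCount_step (by omega) ?_).le) (by simp [hq])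
    rw [Finset.mem_Icc] at hj
    omega

/-- The same two moves in the other order, starting from a point of the polar cone. -/
theorem HasFlat.point_obliterate [Infinite K] {d : ℕ} (hd : 1 ≤ d)
    (hK : ∀ p : Polynomial K, p.natDegree ≤ d → p.Splits) {ℓ : ℕ → ℕ} {n : ℕ}
    (h : HasFlat K 1 (d - 1) (polarConeType (d - 1) (oblitCount d ℓ)) n) :
    HasFlat K 1 d (polarConeType d ℓ) (n + ℓ d) := by
  generalize hq : ℓ d = q
  induction q generalizing ℓ with
  | zero =>
    refine (h.mono fun j hj => ?_).of_zero ((polarConeType_top d ℓ).trans hq)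
    rw [Finset.mem_Icc] at hj
    rw [polarConeType_pred hq]
    refine (polarConeType_congr hj.1 fun i hi => ?_).le
    rw [Finset.mem_Icc] at hi
    exact (oblitCount_of_zero hq (by omega)).symm
  | succ q ih =>
    refine HasFlat.point_of_line hd hK (HasFlat.line_of_point ?_)
    rw [polarConeType_top]
    refine ih (h.mono fun j hj => ?_) (by simp [hq])
    rw [Finset.mem_Icc] at hj
    refine (polarConeType_congr hj.1 fun i hi => ?_).le
    rw [Finset.mem_Icc] at hi
    exact oblitCount_step (by omega) (by omega)

end Obliterate

/-! ### Shifting the least bound from which a property holds. -/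

section Threshold

/-- The least `N ≥ c` from which on `P` holds. -/
def threshold (c : ℕ) (P : ℕ → Prop) : ℕ∞ :=
  sInf {N : ℕ∞ | (c : ℕ∞) ≤ N ∧ ∀ n : ℕ, N ≤ n → P n}

theorem threshold_mem (c : ℕ) (P : ℕ → Prop) :
    (c : ℕ∞) ≤ threshold c P ∧ ∀ n : ℕ, threshold c P ≤ n → P n :=
  csInf_mem (s := {N : ℕ∞ | (c : ℕ∞) ≤ N ∧ ∀ n : ℕ, N ≤ n → P n})
    ⟨⊤, le_top, fun n hn => absurd hn (by simp)⟩

theorem threshold_le {c a : ℕ} {P : ℕ → Prop} (hc : c ≤ a) (h : ∀ n, a ≤ n → P n) :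
    threshold c P ≤ a :=
  sInf_le ⟨by exact_mod_cast hc, fun n hn => h n (by exact_mod_cast hn)⟩

theorem threshold_le_add {c m : ℕ} {P Q : ℕ → Prop} (h : ∀ n, P n → Q (n + m)) :
    threshold c Q ≤ threshold c P + m := by
  obtain ⟨h1, h2⟩ := threshold_mem c P
  generalize threshold c P = N at h1 h2 ⊢
  induction N with
  | top => simp
  | coe a =>
    have h1 : c ≤ a := by exact_mod_cast h1
    refine (threshold_le (a := a + m) (by omega) fun n hn => ?_).trans (by simp)
    have := h _ (h2 (n - m) (by exact_mod_cast (by omega : a ≤ n - m)))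
    rwa [Nat.sub_add_cancel (by omega)] at this

/-- Failure of `P` at `0` is failure of `Q` at `m`, so the threshold of `Q` exceeds `m` and can be
lowered by `m` without truncation. The result is at least `1`, hence respects the floor `c`. -/
theorem threshold_add_eq {c m : ℕ} {P Q : ℕ → Prop} (h : ∀ n, P n ↔ Q (n + m)) (hc : c ≤ 1)
    (h0 : ¬ P 0) : threshold c P + m = threshold c Q := by
  refine le_antisymm ?_ (threshold_le_add fun n => (h n).1)
  obtain ⟨h1, h2⟩ := threshold_mem c Q
  generalize threshold c Q = N at h1 h2 ⊢
  induction N with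
  | top => simp
  | coe a =>
    have ha : m < a := by
      by_contra hle
      refine h0 ((h 0).2 ?_)
      rw [zero_add]
      exact h2 m (by exact_mod_cast (by omega : a ≤ m))
    have : threshold c P ≤ (a - m : ℕ) := threshold_le (by omega) fun n hn =>
      (h n).2 (h2 _ (by exact_mod_cast (by omega : a ≤ n + m)))
    calc threshold c P + m ≤ (a - m : ℕ) + m := by gcongr
      _ = a := by exact_mod_cast Nat.sub_add_cancel ha.le

theorem minDimBound_eq_threshold (F : Type u) [Field F] (d : ℕ) (ℓ : ℕ → ℕ) :
    minDimBound F d ℓ = threshold 1 fun r => CanDeterminePoint F d ℓ (r + 1) := by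
  simp only [minDimBound, threshold, Nat.cast_one]

theorem numVarsLinear_eq_threshold (F : Type u) [Field F] (d : ℕ) (ℓ : ℕ → ℕ) :
    numVarsLinear F d ℓ = threshold 0 (CanDetermineLine F d ℓ) := by
  simp [numVarsLinear, threshold]

end Threshold

/-! ### Fields closed under adjunctions depending on few parameters. -/

section Closed

/-- Puts the witness polynomial over `E` itself, so that it can be moved along ring maps. -/
theorem isAlgebraic_adjoin_iff_exists {F E : Type u} [Field F] [Field E] [Algebra F E]
    {s : Set E} {y : E} : IsAlgebraic (Algebra.adjoin F s) y ↔
      ∃ p : Polynomial E, p ≠ 0 ∧ (∀ i, p.coeff i ∈ Algebra.adjoin F s) ∧ p.eval y = 0 := by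
  constructor
  · rintro ⟨p, hp, hy⟩
    refine ⟨p.map (algebraMap _ E), ?_, fun i => ?_, ?_⟩
    · rwa [Ne, Polynomial.map_eq_zero_iff Subtype.val_injective]
    · rw [Polynomial.coeff_map]
      exact (p.coeff i).2
    · rwa [Polynomial.eval_map_algebraMap]
  · rintro ⟨p, hp, hc, hy⟩
    obtain ⟨q, rfl⟩ := (Polynomial.mem_lifts (f := algebraMap (Algebra.adjoin F s) E) p).1
      ((Polynomial.lifts_iff_coeff_lifts p).2 fun i => ⟨⟨_, hc i⟩, rfl⟩)
    refine ⟨q, ?_, by rwa [Polynomial.eval_map_algebraMap] at hy⟩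
    rintro rfl
    simp at hp

theorem isAlgebraic_adjoin_iff_intermediateField {F E : Type u} [Field F] [Field E] [Algebra F E]
    {s : Set E} {y : E} : IsAlgebraic (Algebra.adjoin F s) y ↔
      IsAlgebraic (IntermediateField.adjoin F s) y := by
  open IntermediateField.algebraAdjoinAdjoin in
  exact IsFractionRing.isAlgebraic_iff (Algebra.adjoin F s) (IntermediateField.adjoin F s) E

theorem isAlgebraic_adjoin_image {F E E' : Type u} [Field F] [Field E] [Field E'] [Algebra F E]
    [Algebra F E'] (ι : E →ₐ[F] E') {s : Set E} {y : E}
    (h : IsAlgebraic (Algebra.adjoin F s) y) : IsAlgebraic (Algebra.adjoin F (ι '' s)) (ι y) := by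
  obtain ⟨p, hp, hc, hy⟩ := isAlgebraic_adjoin_iff_exists.1 h
  refine isAlgebraic_adjoin_iff_exists.2 ⟨p.map ι.toRingHom, ?_, fun i => ?_, ?_⟩
  · rwa [Ne, Polynomial.map_eq_zero]
  · rw [Polynomial.coeff_map, ← AlgHom.map_adjoin]
    exact ⟨_, hc i, rfl⟩
  · rw [show ι y = ι.toRingHom y from rfl, Polynomial.eval_map, Polynomial.eval₂_hom, hy, map_zero]

variable (F : Type u) [Field F]

/-- Every polynomial over `M` whose coefficients are polynomials in some `m` elements of `M` has all
its roots in `M`. -/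
def IsRDClosed (m : ℕ) (M : Type u) [Field M] [Algebra F M] : Prop :=
  ∀ s : Finset M, s.card ≤ m → ∀ p : Polynomial M,
    (∀ i, p.coeff i ∈ Algebra.adjoin F (s : Set M)) → p.Splits

variable {F}
variable {Ω : Type u} [Field Ω] [Algebra F Ω]

/-- The subfield `N` of `Ω` contains every element of `Ω` that is algebraic over the field generated
by some `m` elements of `N`. -/
def IsRDClosedIn (m : ℕ) (N : IntermediateField F Ω) : Prop :=
  ∀ s : Finset Ω, s.card ≤ m → (s : Set Ω) ⊆ N → ∀ y : Ω,
    IsAlgebraic (Algebra.adjoin F (s : Set Ω)) y → y ∈ N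

theorem IsRDClosedIn.isRDClosed [IsAlgClosed Ω] {m : ℕ} {N : IntermediateField F Ω}
    (h : IsRDClosedIn m N) : IsRDClosed F m N := by
  classical
  intro s hs p hp
  by_cases hp0 : p = 0
  · rw [hp0]
    exact Polynomial.Splits.zero
  refine Polynomial.Splits.of_splits_map (algebraMap N Ω) (IsAlgClosed.splits _) fun y hy => ?_
  have hy' := Polynomial.isRoot_of_mem_roots hy
  refine ⟨⟨y, h (s.image N.val) (Finset.card_image_le.trans hs) ?_ y ?_⟩, rfl⟩
  · intro x hx
    rw [Finset.coe_image] at hx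
    obtain ⟨x, -, rfl⟩ := hx
    exact x.2
  · rw [isAlgebraic_adjoin_iff_exists]
    refine ⟨p.map (algebraMap N Ω), by rwa [Ne, Polynomial.map_eq_zero], fun i => ?_, hy'⟩
    rw [Polynomial.coeff_map, Finset.coe_image, ← AlgHom.map_adjoin]
    exact ⟨_, hp i, rfl⟩

/-- The equation of `y` pulls back along `ι` to a polynomial that splits over `M`, so all its roots
in `Ω` come from `M`. -/
theorem IsRDClosed.fieldRange {m : ℕ} {M : Type u} [Field M] [Algebra F M]
    (h : IsRDClosed F m M) (ι : M →ₐ[F] Ω) : IsRDClosedIn m ι.fieldRange := by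
  classical
  intro s hs hsι y hy
  obtain ⟨s', hs', rfl⟩ : ∃ s' : Finset M, s'.card = s.card ∧ s'.image ι = s := by
    have e : (s.preimage ι ι.injective.injOn).image ι = s := by
      rw [Finset.image_preimage]
      exact Finset.filter_true_of_mem fun x hx => hsι hx
    refine ⟨s.preimage ι ι.injective.injOn, ?_, e⟩
    conv_rhs => rw [← e]
    exact (Finset.card_image_of_injective _ ι.injective).symm
  obtain ⟨p, hp, hc, hy⟩ := isAlgebraic_adjoin_iff_exists.1 hy
  rw [Finset.coe_image] at hc
  simp only [← AlgHom.map_adjoin] at hc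
  choose c hc' hcp using hc
  obtain ⟨q, rfl⟩ := (Polynomial.mem_lifts (f := ι.toRingHom) p).1
      ((Polynomial.lifts_iff_coeff_lifts p).2 fun i => ⟨c i, hcp i⟩)
  have hq0 : q ≠ 0 := by
    rintro rfl
    simp at hp
  have hq : q.Splits := h s' (hs'.trans_le hs) q fun i => by
    have := hcp i
    rw [Polynomial.coeff_map] at this
    rw [← ι.injective this]
    exact hc' i
  exact hq.mem_range_of_isRoot hq0 (i := ι.toRingHom) hy

/-- The subfields of `Ω` that are obtained from `K` by finitely many adjunctions of one element
algebraic over the field generated by `m` elements of the subfield at hand. -/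
inductive Reach (m : ℕ) (K : IntermediateField F Ω) : IntermediateField F Ω → Prop
  | base : Reach m K K
  | step (A : IntermediateField F Ω) (s : Finset Ω) (y : Ω) : Reach m K A → s.card ≤ m →
      (s : Set Ω) ⊆ A → IsAlgebraic (Algebra.adjoin F (s : Set Ω)) y →
      Reach m K (A ⊔ IntermediateField.adjoin F {y})

variable {m : ℕ} {K A B : IntermediateField F Ω}

theorem Reach.le (h : Reach m K A) : K ≤ A := by
  induction h with
  | base => exact le_rfl
  | step A s y _ _ _ _ ih => exact ih.trans le_sup_left

/-- The adjunctions that lead to `B` can be repeated on top of `A`. This makes the reachable fields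
directed, so their supremum is their union. -/
theorem Reach.sup (hA : Reach m K A) (hB : Reach m K B) : Reach m K (A ⊔ B) := by
  induction hB with
  | base => rwa [sup_eq_left.2 hA.le]
  | step B s y _ hs hsB hy ih =>
    rw [← sup_assoc]
    exact .step _ s y ih hs (hsB.trans (le_sup_right : B ≤ A ⊔ B)) hy

variable (m K) in
/-- The smallest subfield of `Ω` that contains `K` and satisfies `IsRDClosedIn m`. -/
def rdClosure : IntermediateField F Ω :=
  ⨆ A : {A : IntermediateField F Ω // Reach m K A}, A.1

theorem mem_rdClosure {y : Ω} : y ∈ rdClosure m K ↔ ∃ A, Reach m K A ∧ y ∈ A := by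
  have : Nonempty {A : IntermediateField F Ω // Reach m K A} := ⟨⟨K, .base⟩⟩
  have h := IntermediateField.coe_iSup_of_directed
    (t := fun A : {A : IntermediateField F Ω // Reach m K A} => A.1)
    fun A B => ⟨⟨_, A.2.sup B.2⟩, le_sup_left, le_sup_right⟩
  rw [← SetLike.mem_coe, rdClosure, h]
  simp

theorem le_rdClosure : K ≤ rdClosure m K := fun _ hx => mem_rdClosure.2 ⟨K, .base, hx⟩

theorem exists_reach_of_finset (s : Finset Ω) (hs : (s : Set Ω) ⊆ rdClosure m K) :
    ∃ A, Reach m K A ∧ (s : Set Ω) ⊆ A := by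
  classical
  induction s using Finset.induction_on with
  | empty => exact ⟨K, .base, by simp⟩
  | insert x s _ ih =>
    rw [Finset.coe_insert, Set.insert_subset_iff] at hs
    obtain ⟨A, hA, hsA⟩ := ih hs.2
    obtain ⟨B, hB, hxB⟩ := mem_rdClosure.1 hs.1
    refine ⟨A ⊔ B, hA.sup hB, ?_⟩
    rw [Finset.coe_insert, Set.insert_subset_iff]
    exact ⟨(le_sup_right : B ≤ A ⊔ B) hxB, hsA.trans (le_sup_left : A ≤ A ⊔ B)⟩

/-- The finitely many parameters lie in one reachable field, and one more adjunction from there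
reaches `y`. -/
theorem isRDClosedIn_rdClosure : IsRDClosedIn m (rdClosure m K) := by
  intro s hs hsK y hy
  obtain ⟨A, hA, hsA⟩ := exists_reach_of_finset s hsK
  exact mem_rdClosure.2 ⟨_, .step A s y hA hs hsA hy, (le_sup_right :
    IntermediateField.adjoin F {y} ≤ _) (IntermediateField.mem_adjoin_simple_self F y)⟩

end Closed

/-! ### Towers of small essential dimension stay inside closed fields. -/

section Tower

variable {F E Ω : Type u} [Field F] [Field E] [Field Ω] [Algebra F E] [Algebra F Ω]

/-- The infimum defining `essDim` is attained, since `A` and `B` themselves form a descent. -/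
theorem exists_descent_of_essDim_le {m : ℕ} {A B : IntermediateField F E} (hAB : A ≤ B)
    (h : essDim A B ≤ m) : ∃ A₀ B₀ : IntermediateField F E, A₀ ≤ A ∧ A₀ ≤ B₀ ∧ A ⊔ B₀ = B ∧
      IntermediateField.relfinrank A₀ B₀ = IntermediateField.relfinrank A B ∧
      Algebra.trdeg F A₀ ≤ m := by
  obtain ⟨A₀, B₀, h1, h2, h3, h4, h5⟩ := csInf_mem (s := {e : ℕ∞ | ∃ A₀ B₀ : IntermediateField F E,
    A₀ ≤ A ∧ A₀ ≤ B₀ ∧ A ⊔ B₀ = B ∧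
    IntermediateField.relfinrank A₀ B₀ = IntermediateField.relfinrank A B ∧
    e = Cardinal.toENat (Algebra.trdeg F A₀)}) ⟨_, A, B, le_rfl, hAB, sup_eq_right.2 hAB, rfl, rfl⟩
  refine ⟨A₀, B₀, h1, h2, h3, h4, ?_⟩
  rw [essDim, h5] at h
  exact Cardinal.toENat_le_natCast.1 h

/-- The step is generated by `B₀`, which is algebraic over a transcendence basis of `A₀` with at
most `m` elements; closedness absorbs it element by element. -/
theorem IsRDClosedIn.map_le_of_step {m : ℕ} {N : IntermediateField F Ω} (hN : IsRDClosedIn m N)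
    (ι : E →ₐ[F] Ω) {A B : IntermediateField F E} (hAB : A ≤ B)
    (hfin : IntermediateField.relfinrank A B ≠ 0) (h : essDim A B ≤ m) (hA : A.map ι ≤ N) :
    B.map ι ≤ N := by
  classical
  obtain ⟨A₀, B₀, h1, h2, h3, h4, h5⟩ := exists_descent_of_essDim_le hAB h
  rw [← h3, IntermediateField.map_sup, sup_le_iff]
  refine ⟨hA, ?_⟩
  rintro _ ⟨y, hy, rfl⟩
  -- The relative rank is `0` for infinite extensions, so being nonzero encodes finiteness of `B₀ /
  -- A₀`.
  rw [← h4, IntermediateField.relfinrank_eq_finrank_of_le h2] at hfin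
  have : FiniteDimensional A₀ (IntermediateField.extendScalars h2) :=
    Module.finite_of_finrank_pos (Nat.pos_of_ne_zero hfin)
  have hyA : IsAlgebraic A₀ y := by
    have := Algebra.IsAlgebraic.isAlgebraic (R := A₀)
      (⟨y, hy⟩ : IntermediateField.extendScalars h2)
    exact this.algHom (IntermediateField.val _)
  obtain ⟨s, hs⟩ := exists_isTranscendenceBasis F A₀
  rw [← hs.cardinalMk_eq_trdeg] at h5
  have hsf : s.Finite := Cardinal.lt_aleph0_iff_set_finite.1 (h5.trans_lt (Cardinal.natCast_lt_aleph0))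
  lift s to Finset A₀ using hsf
  have hsm : s.card ≤ m := by
    have e : Cardinal.mk {x // x ∈ (s : Set A₀)} = s.card := Cardinal.mk_coe_finset
    rw [e] at h5
    exact_mod_cast h5
  have halg : Algebra.IsAlgebraic (Algebra.adjoin F (s : Set A₀)) A₀ := by
    have := hs.isAlgebraic
    rwa [Subtype.range_coe] at this
  have hys : IsAlgebraic (Algebra.adjoin F (A₀.val '' s)) y := by
    have h6 : IsAlgebraic (Algebra.adjoin F (s : Set A₀)) y := hyA.restrictScalars _
    have hmem : ∀ x : Algebra.adjoin F (s : Set A₀),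
        A₀.val x.1 ∈ Algebra.adjoin F (A₀.val '' (s : Set A₀)) := fun x => by
      rw [← AlgHom.map_adjoin]
      exact ⟨_, x.2, rfl⟩
    refine h6.ringHom_of_comp_eq (((A₀.val.comp (Algebra.adjoin F (s : Set A₀)).val).codRestrict
      _ hmem).toRingHom) (RingHom.id E) (fun x x' hxx => ?_) rfl
    exact Subtype.ext (Subtype.ext (congrArg
      (fun z : Algebra.adjoin F (A₀.val '' (s : Set A₀)) => (z : E)) hxx))
  have := isAlgebraic_adjoin_image ι hys
  refine hN ((s.image A₀.val).image ι)
    (Finset.card_image_le.trans (Finset.card_image_le.trans hsm)) ?_ _ 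
      (by rwa [Finset.coe_image, Finset.coe_image])
  intro x hx
  simp only [Finset.coe_image] at hx
  obtain ⟨_, ⟨x, -, rfl⟩, rfl⟩ := hx
  exact hA ⟨_, h1 x.2, rfl⟩

theorem IsTower.map_le {K : Type u} [Field K] [Algebra F K] [Algebra K E] [IsScalarTower F K E]
    {m' : ℕ∞} {k : ℕ} (h : IsTower F K E m') (hm : m' ≤ k) {N : IntermediateField F Ω}
    (hN : IsRDClosedIn k N)
    (ι : E →ₐ[F] Ω) (hK : ∀ x : K, ι (algebraMap K E x) ∈ N) (x : E) : ι x ∈ N := by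
  obtain ⟨t, T, h0, ht, hT⟩ := h
  have key : ∀ i ≤ t, (T i).map ι ≤ N := by
    intro i
    induction i with
    | zero =>
      rintro - _ ⟨x, hx, rfl⟩
      rw [h0] at hx
      obtain ⟨x, rfl⟩ := hx
      exact hK x
    | succ i ih =>
      intro hi
      obtain ⟨h1, h2, h3⟩ := hT i (by omega)
      exact hN.map_le_of_step ι h1 h2 (h3.trans hm) (ih (by omega))
  refine key t le_rfl ⟨x, ?_, rfl⟩
  rw [ht]
  trivial

end Tower

/-! ### Conversely, elements of the closure lie in such towers. -/

section ReachTower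

variable {F Ω : Type u} [Field F] [Field Ω] [Algebra F Ω]

theorem relfinrank_sup_adjoin_simple (A : IntermediateField F Ω) {y : Ω} (hy : IsIntegral A y) :
    IntermediateField.relfinrank A (A ⊔ IntermediateField.adjoin F {y}) =
      (minpoly A y).natDegree := by
  have e : A ⊔ IntermediateField.adjoin F {y} =
      (IntermediateField.adjoin A {y}).restrictScalars F :=
    (IntermediateField.restrictScalars_adjoin_eq_sup F A {y}).symm
  rw [IntermediateField.relfinrank_eq_finrank_of_le le_sup_left,
    ← IntermediateField.adjoin.finrank hy]
  have key : ∀ (B : IntermediateField F Ω) (h : A ≤ B),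
      B = (IntermediateField.adjoin A {y}).restrictScalars F →
      Module.finrank A (IntermediateField.extendScalars h) =
        Module.finrank A (IntermediateField.adjoin A {y}) := by
    rintro _ h rfl
    rfl
  exact key _ _ e

theorem trdeg_le_of_isAlgebraic_adjoin {m : ℕ} {s : Finset Ω} (hs : s.card ≤ m)
    {A : IntermediateField F Ω} (hsA : (s : Set Ω) ⊆ A)
    (h : ∀ y ∈ A, IsAlgebraic (Algebra.adjoin F (s : Set Ω)) y) : Algebra.trdeg F A ≤ m := by
  classical
  let s' : Finset A := s.preimage A.val A.val.injective.injOn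
  have e : s'.image A.val = s := by
    rw [Finset.image_preimage]
    exact Finset.filter_true_of_mem fun x hx => ⟨⟨x, hsA hx⟩, rfl⟩
  have hmem : ∀ x : Algebra.adjoin F (s' : Set A),
      A.val x.1 ∈ Algebra.adjoin F (s : Set Ω) := fun x => by
    rw [← e, Finset.coe_image, ← AlgHom.map_adjoin]
    exact ⟨_, x.2, rfl⟩
  have halg : Algebra.IsAlgebraic (Algebra.adjoin F (s' : Set A)) A := by
    refine ⟨fun y => (h y y.2).of_ringHom_of_comp_eq
      (((A.val.comp (Algebra.adjoin F (s' : Set A)).val).codRestrict _ hmem).toRingHom) A.val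
      (fun x => ?_) A.val.injective rfl⟩
    obtain ⟨x, hx⟩ := x
    have hx' := hx
    rw [← e, Finset.coe_image, ← AlgHom.map_adjoin] at hx'
    obtain ⟨z, hz, rfl⟩ := hx'
    exact ⟨⟨z, hz⟩, rfl⟩
  refine (Algebra.IsAlgebraic.trdeg_le_cardinalMk F (s' : Set A)).trans ?_
  have e1 : Cardinal.mk {x // x ∈ (s' : Set A)} = s'.card := Cardinal.mk_coe_finset
  rw [e1]
  have : s'.card = s.card := by
    rw [← e]
    exact (Finset.card_image_of_injective _ A.val.injective).symm
  exact_mod_cast this.trans_le hs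

theorem isIntegral_of_isAlgebraic_adjoin {A : IntermediateField F Ω} {s : Set Ω} {y : Ω}
    (hsA : s ⊆ A) (hy : IsAlgebraic (Algebra.adjoin F s) y) : IsIntegral A y := by
  have hle : Algebra.adjoin F s ≤ A.toSubalgebra := Algebra.adjoin_le hsA
  exact (hy.ringHom_of_comp_eq (Subalgebra.inclusion hle).toRingHom (RingHom.id Ω)
    (Subalgebra.inclusion_injective hle) rfl).isIntegral

/-- Descending to `F(s)` alone could change the degree of `y`. The descent field also receives the
coefficients of the minimal polynomial of `y` over `A`; they are algebraic over `F(s)`, so the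
transcendence degree stays at most `m`. -/
theorem essDim_sup_adjoin_simple_le {m : ℕ} {A : IntermediateField F Ω} {s : Finset Ω} {y : Ω}
    (hs : s.card ≤ m) (hsA : (s : Set Ω) ⊆ A)
    (hy : IsAlgebraic (Algebra.adjoin F (s : Set Ω)) y) :
    essDim A (A ⊔ IntermediateField.adjoin F {y}) ≤ m := by
  have hyA : IsIntegral A y := isIntegral_of_isAlgebraic_adjoin hsA hy
  set p : Polynomial A := minpoly A y with hp
  let c : Set Ω := s ∪ Set.range fun i => (p.coeff i : Ω)
  let A₀ : IntermediateField F Ω := IntermediateField.adjoin F c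
  have hA₀A : A₀ ≤ A := by
    refine IntermediateField.adjoin_le_iff.2 (Set.union_subset hsA ?_)
    rintro _ ⟨i, rfl⟩
    exact (p.coeff i).2
  have hyA₀ : IsIntegral A₀ y := isIntegral_of_isAlgebraic_adjoin
    (Set.subset_union_left.trans (IntermediateField.subset_adjoin F c)) hy
  have htr : Algebra.trdeg F A₀ ≤ m := by
    refine trdeg_le_of_isAlgebraic_adjoin hs
      (Set.subset_union_left.trans (IntermediateField.subset_adjoin F c)) fun z hz => ?_
    let L := IntermediateField.adjoin F (s : Set Ω)
    have hyL : IsIntegral L y := (isAlgebraic_adjoin_iff_intermediateField.1 hy).isIntegral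
    have hle : A₀ ≤ (algebraicClosure L Ω).restrictScalars F := by
      refine IntermediateField.adjoin_le_iff.2 (Set.union_subset (fun x hx => ?_) ?_)
      · exact mem_algebraicClosure_iff.2 (isAlgebraic_algebraMap (A := Ω)
          (⟨x, IntermediateField.subset_adjoin F _ hx⟩ : L))
      · rintro _ ⟨i, rfl⟩
        have hLA : L ≤ A := IntermediateField.adjoin_le_iff.2 hsA
        -- Coefficients of a monic divisor of a monic polynomial over `L` are integral over `L`.
        have hdvd : p.map (algebraMap A Ω) ∣ (minpoly L y).map (algebraMap L Ω) := by
          have h1 : p ∣ (minpoly L y).map (IntermediateField.inclusion hLA).toRingHom := by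
            refine minpoly.dvd A y ?_
            rw [Polynomial.aeval_def, Polynomial.eval₂_map]
            exact minpoly.aeval L y
          have h2 := Polynomial.map_dvd (algebraMap A Ω) h1
          rwa [Polynomial.map_map] at h2
        have := Polynomial.isIntegral_coeff_of_dvd (minpoly L y) (p.map (algebraMap A Ω))
          (minpoly.monic hyL) ((minpoly.monic hyA).map _) hdvd i
        rw [Polynomial.coeff_map] at this
        exact mem_algebraicClosure_iff.2 this.isAlgebraic
    exact isAlgebraic_adjoin_iff_intermediateField.2 (mem_algebraicClosure_iff.1 (hle hz))
  refine le_trans (sInf_le ⟨A₀, A₀ ⊔ IntermediateField.adjoin F {y}, hA₀A, le_sup_left, ?_, ?_,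
    rfl⟩) (Cardinal.toENat_le_natCast.2 htr)
  · rw [← sup_assoc, sup_eq_left.2 hA₀A]
  · rw [relfinrank_sup_adjoin_simple A hyA, relfinrank_sup_adjoin_simple A₀ hyA₀]
    -- By construction `p` has coefficients in `A₀`, so the minimal polynomials of `y` over `A₀` and
    -- over `A` have equal degree.
    obtain ⟨q, hq⟩ := (Polynomial.mem_lifts (f := algebraMap A₀ Ω) (p.map (algebraMap A Ω))).1
      ((Polynomial.lifts_iff_coeff_lifts _).2 fun i => ⟨⟨p.coeff i,
        IntermediateField.subset_adjoin F c (Or.inr ⟨i, rfl⟩)⟩, by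
          rw [Polynomial.coeff_map]; rfl⟩)
    have hqm : q ≠ 0 := by
      rintro rfl
      rw [Polynomial.map_zero] at hq
      exact (Polynomial.map_monic_ne_zero (minpoly.monic hyA)) hq.symm
    have hqd : q.natDegree = p.natDegree := by
      rw [← Polynomial.natDegree_map (algebraMap A₀ Ω), hq, Polynomial.natDegree_map]
    refine le_antisymm ?_ ?_
    · rw [← hqd]
      refine Polynomial.natDegree_le_of_dvd (minpoly.dvd A₀ y ?_) hqm
      rw [← Polynomial.eval_map_algebraMap, hq, Polynomial.eval_map_algebraMap]
      exact minpoly.aeval A y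
    · have h1 : p ∣ (minpoly A₀ y).map (IntermediateField.inclusion hA₀A).toRingHom := by
        refine minpoly.dvd A y ?_
        rw [Polynomial.aeval_def, Polynomial.eval₂_map]
        exact minpoly.aeval A₀ y
      have := Polynomial.natDegree_le_of_dvd h1
        (Polynomial.map_monic_ne_zero (minpoly.monic hyA₀))
      rwa [Polynomial.natDegree_map] at this

/-- Any descent of `B / A` lies inside `B`, hence in the image of `ι`, and can be pulled back with
its degree and transcendence degree. -/
theorem essDim_comap_le {E : Type u} [Field E] [Algebra F E] (ι : E →ₐ[F] Ω)
    {A B : IntermediateField F Ω} (hAB : A ≤ B) (hB : B ≤ ι.fieldRange) :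
    essDim (A.comap ι) (B.comap ι) ≤ essDim A B := by
  refine le_sInf ?_
  rintro _ ⟨A₀, B₀, h1, h2, h3, h4, rfl⟩
  have hB₀ : B₀ ≤ B := le_sup_right.trans h3.le
  have hA₀ : A₀ ≤ ι.fieldRange := h2.trans (hB₀.trans hB)
  refine sInf_le ⟨A₀.comap ι, B₀.comap ι, fun _ hx => h1 hx,
    fun _ hx => h2 hx, ?_, ?_, ?_⟩
  · refine IntermediateField.map_injective ι ?_
    rw [IntermediateField.map_sup, IntermediateField.map_comap_eq_self (hAB.trans hB),
      IntermediateField.map_comap_eq_self (hB₀.trans hB), IntermediateField.map_comap_eq_self hB,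
      h3]
  · rw [IntermediateField.relfinrank_comap_comap_eq_relfinrank_of_le _ _ ι (hB₀.trans hB),
      IntermediateField.relfinrank_comap_comap_eq_relfinrank_of_le _ _ ι hB, h4]
  · congr 1
    have e : A₀ = (A₀.comap ι).map ι := (IntermediateField.map_comap_eq_self hA₀).symm
    conv_lhs => rw [e]
    exact ((A₀.comap ι).equivMap ι).symm.trdeg_eq

theorem Reach.exists_tower {m : ℕ} {K A : IntermediateField F Ω} (h : Reach m K A) :
    ∃ (t : ℕ) (T : ℕ → IntermediateField F Ω), T 0 = K ∧ T t = A ∧ ∀ i < t, T i ≤ T (i + 1) ∧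
      IntermediateField.relfinrank (T i) (T (i + 1)) ≠ 0 ∧ essDim (T i) (T (i + 1)) ≤ m := by
  induction h with
  | base => exact ⟨0, fun _ => K, rfl, rfl, by simp⟩
  | step A s y _ hs hsA hy ih =>
    obtain ⟨t, T, h0, ht, hT⟩ := ih
    refine ⟨t + 1, fun i => if i ≤ t then T i else A ⊔ IntermediateField.adjoin F {y}, by simpa,
      by simp, fun i hi => ?_⟩
    rcases Nat.lt_succ_iff_lt_or_eq.1 hi with hi' | rfl
    · have := hT i hi'
      simpa only [if_pos hi'.le, if_pos (Nat.succ_le_of_lt hi')] using this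
    · simp only [le_refl, if_true, Nat.not_succ_le_self, if_false, ht]
      have hyA : IsIntegral A y := isIntegral_of_isAlgebraic_adjoin hsA hy
      refine ⟨le_sup_left, ?_, essDim_sup_adjoin_simple_le hs hsA hy⟩
      rw [relfinrank_sup_adjoin_simple A hyA]
      exact (minpoly.natDegree_pos hyA).ne'

/-- Finitely many elements of the closure of `K` lie in an extension of resolvent degree at most
`m`. -/
theorem exists_resolventDegree_le {K : Type u} [Field K] [Algebra F K] [Algebra K Ω]
    [IsScalarTower F K Ω] {m : ℕ} (s : Finset Ω)
    (hs : (s : Set Ω) ⊆ rdClosure m (IsScalarTower.toAlgHom F K Ω).fieldRange) :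
    ∃ (K' : Type u) (_ : Field K') (_ : Algebra K K'), resolventDegree F K K' ≤ m ∧
      ∃ φ : K' →ₐ[K] Ω, (s : Set Ω) ⊆ Set.range φ ∧
        ∀ x, φ x ∈ rdClosure m (IsScalarTower.toAlgHom F K Ω).fieldRange := by
  obtain ⟨A, hA, hsA⟩ := exists_reach_of_finset s hs
  obtain ⟨t, T, h0, ht, hT⟩ := hA.exists_tower
  let j : K →ₐ[F] A := (IsScalarTower.toAlgHom F K Ω).codRestrict A.toSubalgebra
    fun x => hA.le ⟨x, rfl⟩
  let : Algebra K A := j.toRingHom.toAlgebra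
  have : IsScalarTower F K A := IsScalarTower.of_algHom j
  have hmono : ∀ i ≤ t, T i ≤ A := by
    intro i hi
    induction hi using Nat.decreasingInduction with
    | self => exact ht.le
    | of_succ i hi ih => exact (hT i hi).1.trans ih
  have hr : A.val.fieldRange = A := A.fieldRange_val
  refine ⟨A, inferInstance, inferInstance, sInf_le ⟨A, inferInstance, inferInstance, inferInstance,
    inferInstance, ⟨t, fun i => (T i).comap A.val, ?_, ?_, fun i hi => ⟨?_, ?_, ?_⟩⟩,
    ⟨AlgHom.id K A⟩⟩, { A.val.toRingHom with commutes' := fun x => rfl }, fun x hx =>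
      ⟨⟨x, hsA hx⟩, rfl⟩, fun x => mem_rdClosure.2 ⟨A, hA, x.2⟩⟩
  · simp only [h0]
    ext x
    constructor
    · rintro ⟨z, hz⟩
      exact ⟨z, Subtype.ext hz⟩
    · rintro ⟨z, hz⟩
      exact ⟨z, congrArg Subtype.val hz⟩
  · simp only [ht]
    ext x
    exact ⟨fun _ => trivial, fun _ => x.2⟩
  · exact fun _ hx => (hT i hi).1 hx
  · rw [IntermediateField.relfinrank_comap_comap_eq_relfinrank_of_le _ _ A.val
      (hr.symm ▸ hmono (i + 1) hi)]
    exact (hT i hi).2.1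
  · exact (essDim_comap_le A.val (hT i hi).1 (hr.symm ▸ hmono (i + 1) hi)).trans (hT i hi).2.2

end ReachTower

/-! ### Specializing elements algebraic over a polynomial ring. -/

section Specialization

/-- A homomorphism to an algebraically closed field extends along an integral extension. -/
theorem exists_algHom_extend_integral {C B A : Type u} [Field C] [IsAlgClosed C] [CommRing B]
    [CommRing A] [Algebra C B] [Algebra B A] [Algebra C A] [IsScalarTower C B A]
    [Algebra.IsIntegral B A] (hinj : Function.Injective (algebraMap B A)) (ev : B →ₐ[C] C) :
    ∃ φ : A →ₐ[C] C, ∀ b, φ (algebraMap B A b) = ev b := by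
  have hmax : (RingHom.ker ev).IsMaximal := RingHom.ker_isMaximal_of_surjective ev
    fun c => ⟨algebraMap C B c, ev.commutes c⟩
  -- Lying over: a maximal ideal above the kernel has residue field integral over `C`, hence equal
  -- to `C`.
  obtain ⟨Q, hQ, hQB⟩ := Ideal.exists_ideal_over_maximal_of_isIntegral (S := A) (RingHom.ker ev)
    (by rw [(RingHom.injective_iff_ker_eq_bot _).1 hinj]; exact bot_le)
  let : Field (A ⧸ Q) := Ideal.Quotient.field Q
  have hev : ∀ b : B, Ideal.Quotient.mk Q (algebraMap B A b) = algebraMap C (A ⧸ Q) (ev b) := by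
    intro b
    have h1 : b - algebraMap C B (ev b) ∈ RingHom.ker ev := by
      rw [RingHom.mem_ker, map_sub, AlgHom.commutes, Algebra.algebraMap_self, RingHom.id_apply,
        sub_self]
    rw [← hQB, Ideal.mem_comap, map_sub, ← IsScalarTower.algebraMap_apply] at h1
    exact Ideal.Quotient.eq.2 h1
  have hint : Algebra.IsIntegral C (A ⧸ Q) := by
    refine ⟨fun x => ?_⟩
    obtain ⟨a, rfl⟩ := Ideal.Quotient.mk_surjective x
    obtain ⟨p, hp, hpa⟩ := Algebra.IsIntegral.isIntegral (R := B) a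
    refine ⟨p.map ev.toRingHom, hp.map _, ?_⟩
    rw [Polynomial.eval₂_map]
    have e : (algebraMap C (A ⧸ Q)).comp ev.toRingHom =
        (Ideal.Quotient.mk Q).comp (algebraMap B A) := RingHom.ext fun b => (hev b).symm
    rw [e, ← Polynomial.hom_eval₂, hpa, map_zero]
  have hbij := IsAlgClosed.algebraMap_bijective_of_isIntegral (k := C) (K := A ⧸ Q)
  let e := AlgEquiv.ofBijective (Algebra.ofId C (A ⧸ Q)) hbij
  refine ⟨e.symm.toAlgHom.comp (Ideal.Quotient.mkₐ C Q), fun b => ?_⟩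
  change e.symm (Ideal.Quotient.mk Q (algebraMap B A b)) = ev b
  rw [hev, AlgEquiv.symm_apply_eq]
  rfl

/-- Generic specializations of the elements of an algebraic extension. -/
theorem exists_algHom_specialization {C B Ω : Type u} [Field C] [IsAlgClosed C] [CommRing B]
    [IsDomain B] [Field Ω] [Algebra C B] [Algebra B Ω] [Algebra C Ω] [IsScalarTower C B Ω]
    [Algebra.IsAlgebraic B Ω] (hinj : Function.Injective (algebraMap B Ω)) (T : Finset Ω) :
    ∃ h : B, h ≠ 0 ∧ ∀ ev : B →ₐ[C] C, ev h ≠ 0 →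
      ∃ (R : Subalgebra C Ω) (φ : R →ₐ[C] C), (T : Set Ω) ⊆ R ∧
        ∀ b, ∃ hb : algebraMap B Ω b ∈ R, φ ⟨algebraMap B Ω b, hb⟩ = ev b := by
  -- `h` is a common denominator: `h t` is integral over `B` for every `t ∈ T`.
  obtain ⟨h, h0, hT⟩ := Algebra.IsAlgebraic.exists_integral_multiples B T
  refine ⟨h, h0, fun ev hev => ?_⟩
  let A := integralClosure B Ω
  have hinjA : Function.Injective (algebraMap B A) := fun x y hxy =>
    hinj (congrArg (algebraMap A Ω) hxy)
  obtain ⟨φ₀, hφ₀⟩ := exists_algHom_extend_integral hinjA ev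
  have hfrac : IsFractionRing A Ω := integralClosure.isFractionRing_of_algebraic
    (fun x hx => (map_eq_zero_iff _ hinj).1 hx)
  -- Inverting everything whose specialization is nonzero makes `h` invertible, so `t = (h t) / h`
  -- becomes defined.
  let S : Submonoid A := (nonZeroDivisors C).comap φ₀
  have hS : S ≤ nonZeroDivisors A := fun a ha => by
    refine mem_nonZeroDivisors_of_ne_zero ?_
    rintro rfl
    have : φ₀ 0 ∈ nonZeroDivisors C := ha
    rw [map_zero] at this
    exact zero_notMem_nonZeroDivisors this
  let R₀ : Subalgebra A Ω := Localization.subalgebra.ofField Ω S hS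
  have hunit : ∀ y : S, IsUnit (φ₀.toRingHom y) := fun y =>
    (nonZeroDivisors.ne_zero y.2).isUnit
  let φ : R₀ →+* C := IsLocalization.lift (M := S) hunit
  have hφ : ∀ a : A, φ (algebraMap A R₀ a) = φ₀ a := fun a => IsLocalization.lift_eq hunit a
  refine ⟨R₀.restrictScalars C, { φ with commutes' := fun c => ?_ }, fun t ht => ?_, fun b => ?_⟩
  · have : φ (algebraMap A R₀ (algebraMap C A c)) = c := by
      rw [hφ, AlgHom.commutes]
      rfl
    exact this
  · change ∃ (a s : A) (_ : s ∈ S), t = algebraMap A Ω a * (algebraMap A Ω s)⁻¹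
    refine ⟨⟨h • t, hT t ht⟩, algebraMap B A h, ?_, ?_⟩
    · change φ₀ (algebraMap B A h) ∈ nonZeroDivisors C
      rw [hφ₀]
      exact mem_nonZeroDivisors_of_ne_zero hev
    · change t = (h • t) * (algebraMap B Ω h)⁻¹
      rw [Algebra.smul_def, mul_comm, inv_mul_cancel_left₀]
      rwa [Ne, map_eq_zero_iff _ hinj]
  · exact ⟨(algebraMap A R₀ (algebraMap B A b)).2, (hφ _).trans (hφ₀ b)⟩

variable {F C Ω : Type u} [Field F] [Field C] [Field Ω] [Algebra F C] [Algebra F Ω] [Algebra C Ω]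
  [IsScalarTower F C Ω]

theorem algHom_mk_algebraMap {R : Subalgebra C Ω} (φ : R →ₐ[C] C) (r : F)
    (h : algebraMap F Ω r ∈ R) : φ ⟨algebraMap F Ω r, h⟩ = algebraMap F C r := by
  have e : (⟨algebraMap F Ω r, h⟩ : R) = algebraMap C R (algebraMap F C r) :=
    Subtype.ext (IsScalarTower.algebraMap_apply F C Ω r)
  rw [e, φ.commutes]
  rfl

/-- The elements of `Ω` whose generic specializations over `C` that send the `b i` into `M` have
values in `M`. -/
def specField {ι : Type} (M : IntermediateField F C) (b : ι → Ω) : IntermediateField F Ω where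
  carrier := {y | ∃ T : Finset Ω, ∀ (R : Subalgebra C Ω) (φ : R →ₐ[C] C), (T : Set Ω) ⊆ R →
    (∀ i, ∃ h : b i ∈ R, φ ⟨b i, h⟩ ∈ M) → ∃ h : y ∈ R, φ ⟨y, h⟩ ∈ M}
  mul_mem' := by
    classical
    rintro x y ⟨T, hT⟩ ⟨T', hT'⟩
    refine ⟨T ∪ T', fun R φ hR hb => ?_⟩
    rw [Finset.coe_union, Set.union_subset_iff] at hR
    obtain ⟨hx, hxM⟩ := hT R φ hR.1 hb
    obtain ⟨hy, hyM⟩ := hT' R φ hR.2 hb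
    refine ⟨mul_mem hx hy, ?_⟩
    have := mul_mem hxM hyM
    rwa [← map_mul] at this
  add_mem' := by
    classical
    rintro x y ⟨T, hT⟩ ⟨T', hT'⟩
    refine ⟨T ∪ T', fun R φ hR hb => ?_⟩
    rw [Finset.coe_union, Set.union_subset_iff] at hR
    obtain ⟨hx, hxM⟩ := hT R φ hR.1 hb
    obtain ⟨hy, hyM⟩ := hT' R φ hR.2 hb
    refine ⟨add_mem hx hy, ?_⟩
    have := add_mem hxM hyM
    rwa [← map_add] at this
  algebraMap_mem' r := by
    refine ⟨∅, fun R φ _ _ => ⟨?_, ?_⟩⟩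
    · rw [IsScalarTower.algebraMap_apply F C Ω]
      exact R.algebraMap_mem _
    · rw [algHom_mk_algebraMap]
      exact M.algebraMap_mem r
  inv_mem' := by
    classical
    rintro x ⟨T, hT⟩
    -- Requiring `x⁻¹` to be defined prevents a nonzero `x` from specializing to zero.
    refine ⟨insert x⁻¹ T, fun R φ hR hb => ?_⟩
    rw [Finset.coe_insert, Set.insert_subset_iff] at hR
    obtain ⟨hx, hxM⟩ := hT R φ hR.2 hb
    refine ⟨hR.1, ?_⟩
    have h1 : φ ⟨x⁻¹, hR.1⟩ = (φ ⟨x, hx⟩)⁻¹ := by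
      by_cases hx0 : x = 0
      · have e1 : (⟨x⁻¹, hR.1⟩ : R) = 0 := Subtype.ext (show x⁻¹ = 0 by rw [hx0, inv_zero])
        have e2 : (⟨x, hx⟩ : R) = 0 := Subtype.ext hx0
        rw [e1, e2, map_zero, inv_zero]
      · refine eq_inv_of_mul_eq_one_left ?_
        rw [← map_mul, ← map_one φ]
        exact congrArg φ (Subtype.ext (inv_mul_cancel₀ hx0))
    rw [h1]
    exact inv_mem hxM

variable {ι : Type} {M : IntermediateField F C} {b : ι → Ω}

theorem mem_specField {y : Ω} : y ∈ specField M b ↔ ∃ T : Finset Ω, ∀ (R : Subalgebra C Ω)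
    (φ : R →ₐ[C] C), (T : Set Ω) ⊆ R → (∀ i, ∃ h : b i ∈ R, φ ⟨b i, h⟩ ∈ M) →
      ∃ h : y ∈ R, φ ⟨y, h⟩ ∈ M := Iff.rfl

theorem apply_mem_specField (i : ι) : b i ∈ specField M b :=
  mem_specField.2 ⟨∅, fun _ _ _ hb => hb i⟩

theorem algebraMap_mem_specField {x : C} (hx : x ∈ M) : algebraMap C Ω x ∈ specField M b :=
  mem_specField.2 ⟨∅, fun R φ _ _ => ⟨R.algebraMap_mem x, by
    have : φ ⟨algebraMap C Ω x, R.algebraMap_mem x⟩ = x := φ.commutes x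
    rwa [this]⟩⟩

/-- Specialization turns the equation of `y` over `F[s]` into an equation for its value over the
values of `s`, which are at most `m` elements of `M`; closedness of `M` does the rest. -/
theorem isRDClosedIn_specField {m : ℕ} (hM : IsRDClosedIn m M) :
    IsRDClosedIn m (specField M b) := by
  classical
  intro s hs hsN y hy
  obtain ⟨p, hp0, hpc, hpy⟩ := isAlgebraic_adjoin_iff_exists.1 hy
  have hsN' : ∀ x : s, ∃ T : Finset Ω, ∀ (R : Subalgebra C Ω)
    (φ : R →ₐ[C] C), (T : Set Ω) ⊆ R → (∀ i, ∃ h : b i ∈ R, φ ⟨b i, h⟩ ∈ M) →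
      ∃ h : x.1 ∈ R, φ ⟨x.1, h⟩ ∈ M := fun x => hsN x.2
  choose T hT using hsN'
  -- The value of `y` must be defined, the elements of `s` must take values in `M`, and the inverse
  -- of the leading coefficient keeps the specialized equation nonzero.
  refine mem_specField.2 ⟨insert y (insert p.leadingCoeff⁻¹ (Finset.univ.biUnion T)),
    fun R φ hR hb => ?_⟩
  simp only [Finset.coe_insert, Set.insert_subset_iff] at hR
  obtain ⟨hyR, hlR, hTR⟩ := hR
  refine ⟨hyR, ?_⟩
  have hx : ∀ x : s, ∃ h : x.1 ∈ R, φ ⟨x.1, h⟩ ∈ M := fun x => hT x R φ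
    (fun t ht => hTR (Finset.mem_coe.2 (Finset.mem_biUnion.2 ⟨x, Finset.mem_univ _, ht⟩))) hb
  let RF : Subalgebra F Ω := R.restrictScalars F
  have hsR : Algebra.adjoin F (s : Set Ω) ≤ RF := Algebra.adjoin_le fun x hxs => (hx ⟨x, hxs⟩).1
  let φF : RF →ₐ[F] C := { (φ : R →+* C) with commutes' := fun r => algHom_mk_algebraMap φ r _ }
  let s' : Finset C := Finset.univ.image fun x : s => φ ⟨x.1, (hx x).1⟩
  have hcoef : ∀ z (hz : z ∈ Algebra.adjoin F (s : Set Ω)),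
      φF ⟨z, hsR hz⟩ ∈ Algebra.adjoin F (s' : Set C) := by
    intro z hz
    induction hz using Algebra.adjoin_induction with
    | mem x hxs => exact Algebra.subset_adjoin (Finset.mem_coe.2 (Finset.mem_image.2
        ⟨⟨x, hxs⟩, Finset.mem_univ _, rfl⟩))
    | algebraMap r =>
      have : φF ⟨algebraMap F Ω r, hsR (Subalgebra.algebraMap_mem _ r)⟩ = algebraMap F C r :=
        algHom_mk_algebraMap φ r _
      rw [this]
      exact Subalgebra.algebraMap_mem _ r
    | add x y hx hy h1 h2 =>
      have := add_mem h1 h2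
      rwa [← map_add] at this
    | mul x y hx hy h1 h2 =>
      have := mul_mem h1 h2
      rwa [← map_mul] at this
  obtain ⟨q, rfl⟩ := (Polynomial.mem_lifts (f := algebraMap RF Ω) p).1
      ((Polynomial.lifts_iff_coeff_lifts p).2 fun i => ⟨⟨_, hsR (hpc i)⟩, rfl⟩)
  have hval : ∀ i, φF (q.coeff i) ∈ Algebra.adjoin F (s' : Set C) := by
    intro i
    have h1 := hpc i
    rw [Polynomial.coeff_map] at h1
    exact hcoef _ h1
  refine hM s' ?_ ?_ _ (isAlgebraic_adjoin_iff_exists.2 ⟨q.map φF.toRingHom, ?_, fun i => ?_, ?_⟩)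
  · exact Finset.card_image_le.trans (by simpa using hs)
  · intro z hz
    obtain ⟨x, -, rfl⟩ := Finset.mem_image.1 (Finset.mem_coe.1 hz)
    exact (hx x).2
  · intro h0
    have hinj : Function.Injective (algebraMap RF Ω) := Subtype.val_injective
    have h1 : φF q.leadingCoeff = 0 := by
      have := congrArg (fun r => Polynomial.coeff r q.natDegree) h0
      rwa [Polynomial.coeff_map, Polynomial.coeff_zero] at this
    rw [Polynomial.leadingCoeff_map_of_injective hinj] at hlR
    have hq0 : (q.leadingCoeff : Ω) ≠ 0 := by
      intro h
      refine hp0 ?_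
      have : q.leadingCoeff = 0 := Subtype.ext h
      rw [Polynomial.leadingCoeff_eq_zero.1 this, Polynomial.map_zero]
    have h2 : φF q.leadingCoeff * φF ⟨_, hlR⟩ = 1 := by
      rw [← map_mul, ← map_one φF]
      exact congrArg φF (Subtype.ext (mul_inv_cancel₀ hq0))
    rw [h1, zero_mul] at h2
    exact zero_ne_one h2
  · rw [Polynomial.coeff_map]
    exact hval i
  · have h1 : q.eval ⟨y, hyR⟩ = 0 := by
      refine Subtype.ext ?_
      have := Polynomial.eval₂_hom (p := q) (algebraMap RF Ω) ⟨y, hyR⟩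
      rw [← Polynomial.eval_map] at this
      exact this.symm.trans hpy
    have h2 := Polynomial.eval₂_hom (p := q) φF.toRingHom ⟨y, hyR⟩
    rw [← Polynomial.eval_map, h1, map_zero] at h2
    exact h2

end Specialization

/-! ### The general polynomial and its irreducibility. -/

section Generic

variable (F : Type u) [Field F]

/-- The general polynomial over the polynomial ring in its coefficients. -/
def genericPolyInt (n : ℕ) : Polynomial (MvPolynomial (Fin n) F) :=
  Polynomial.X ^ n + ∑ i : Fin n, Polynomial.C (MvPolynomial.X i) * Polynomial.X ^ (n - 1 - (i : ℕ))

theorem map_genericPolyInt (n : ℕ) : (genericPolyInt F n).map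
    (algebraMap (MvPolynomial (Fin n) F) (GenericField F n)) = genericPoly F n := by
  simp [genericPolyInt, genericPoly, Polynomial.map_sum]

theorem degree_genericPolyInt_tail_lt (n : ℕ) :
    (∑ i : Fin n, Polynomial.C (MvPolynomial.X i : MvPolynomial (Fin n) F) *
      Polynomial.X ^ (n - 1 - (i : ℕ))).degree < ((n : ℕ) : WithBot ℕ) := by
  refine lt_of_le_of_lt (Polynomial.degree_sum_le _ _) ?_
  refine (Finset.sup_lt_iff (WithBot.bot_lt_coe n)).2 fun i _ => ?_
  refine lt_of_le_of_lt (Polynomial.degree_C_mul_X_pow_le _ _) ?_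
  have := i.2
  exact WithBot.coe_lt_coe.2 (by omega : n - 1 - (i : ℕ) < n)

theorem monic_genericPolyInt (n : ℕ) : (genericPolyInt F n).Monic :=
  Polynomial.monic_X_pow_add (degree_genericPolyInt_tail_lt F n)

theorem natDegree_genericPolyInt (n : ℕ) : (genericPolyInt F n).natDegree = n := by
  refine Polynomial.natDegree_eq_of_degree_eq_some ?_
  rw [genericPolyInt, Polynomial.degree_add_eq_left_of_degree_lt, Polynomial.degree_X_pow]
  rw [Polynomial.degree_X_pow]
  exact degree_genericPolyInt_tail_lt F n

theorem coeff_genericPolyInt {n : ℕ} (i : Fin n) :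
    (genericPolyInt F n).coeff (n - 1 - (i : ℕ)) = MvPolynomial.X i := by
  have hi := i.2
  rw [genericPolyInt, Polynomial.coeff_add, Polynomial.coeff_X_pow, if_neg (by omega), zero_add,
    Polynomial.finsetSum_coeff, Finset.sum_eq_single i]
  · simp
  · intro j _ hj
    have hj' := j.2
    rw [Polynomial.coeff_C_mul, Polynomial.coeff_X_pow, if_neg, mul_zero]
    intro h
    exact hj (Fin.ext (by omega))
  · simp

/-- Eisenstein at the ideal of polynomials without constant term, then Gauss's lemma. -/
theorem irreducible_genericPoly {n : ℕ} (hn : 1 ≤ n) : Irreducible (genericPoly F n) := by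
  rw [← map_genericPolyInt,
    ← (monic_genericPolyInt F n).irreducible_iff_irreducible_map_fraction_map]
  let c : MvPolynomial (Fin n) F →+* F := MvPolynomial.constantCoeff
  have hp : (RingHom.ker c).IsPrime := RingHom.ker_isPrime c
  have hcoeff : ∀ k < n, ∃ i : Fin n, (genericPolyInt F n).coeff k = MvPolynomial.X i ∧
      k = n - 1 - i := fun k hk => by
    refine ⟨⟨n - 1 - k, by omega⟩, ?_, by simp; omega⟩
    rw [← coeff_genericPolyInt]
    congr 1
    simp
    omega
  refine Polynomial.IsEisensteinAt.irreducible (𝓟 := RingHom.ker c) ⟨?_, fun {k} hk => ?_, ?_⟩ hp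
    (monic_genericPolyInt F n).isPrimitive (by rw [natDegree_genericPolyInt]; omega)
  · rw [(monic_genericPolyInt F n).leadingCoeff, RingHom.mem_ker, map_one]
    exact one_ne_zero
  · rw [natDegree_genericPolyInt] at hk
    obtain ⟨i, hi, -⟩ := hcoeff k hk
    rw [hi, RingHom.mem_ker]
    exact MvPolynomial.constantCoeff_X F i
  · obtain ⟨i, hi, -⟩ := hcoeff 0 (by omega)
    rw [hi, pow_two]
    intro hmem
    -- A partial derivative of an element of the squared ideal has no constant term, whereas the
    -- derivative of the variable itself is `1`.
    have key : ∀ f ∈ RingHom.ker c * RingHom.ker c, c (MvPolynomial.pderiv i f) = 0 := by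
      intro f hf
      induction hf using Submodule.mul_induction_on' with
      | mem_mul_mem a ha b hb =>
        rw [RingHom.mem_ker] at ha hb
        rw [Derivation.leibniz, map_add, smul_eq_mul, smul_eq_mul, map_mul, map_mul, ha, hb]
        simp
      | add a _ b _ ha hb => rw [map_add, map_add, ha, hb, add_zero]
    have := key _ hmem
    rw [MvPolynomial.pderiv_X_self, map_one] at this
    exact one_ne_zero this

end Generic

/-! ### Algebraicity of towers; attainment of the resolvent degree. -/

section Towers

theorem IsTower.isAlgebraic {F K E : Type u} [Field F] [Field K] [Field E] [Algebra F K]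
    [Algebra F E] [Algebra K E] [IsScalarTower F K E] {m : ℕ∞} (h : IsTower F K E m) :
    Algebra.IsAlgebraic K E := by
  obtain ⟨t, T, h0, ht, hT⟩ := h
  have key : ∀ i ≤ t, T 0 ≤ T i ∧ IntermediateField.relfinrank (T 0) (T i) ≠ 0 := by
    intro i
    induction i with
    | zero => simp
    | succ i ih =>
      intro hi
      obtain ⟨h1, h2, -⟩ := hT i (by omega)
      obtain ⟨h3, h4⟩ := ih (by omega)
      refine ⟨h3.trans h1, ?_⟩
      rw [← IntermediateField.relfinrank_mul_relfinrank h3 h1]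
      exact mul_ne_zero h4 h2
  have h1 := (key t le_rfl).2
  rw [ht, IntermediateField.relfinrank_top_right] at h1
  have : FiniteDimensional (T 0) E := Module.finite_of_finrank_pos (Nat.pos_of_ne_zero h1)
  refine ⟨fun x => ?_⟩
  have hx := Algebra.IsAlgebraic.isAlgebraic (R := T 0) x
  have hmem : ∀ y : K, algebraMap K E y ∈ T 0 := fun y => h0 ▸ ⟨y, rfl⟩
  refine hx.of_ringHom_of_comp_eq ((algebraMap K E).codRestrict (T 0) hmem) (RingHom.id E)
    (fun y => ?_) Function.injective_id rfl
  obtain ⟨z, hz⟩ : y.1 ∈ (IsScalarTower.toAlgHom F K E).fieldRange := h0 ▸ y.2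
  exact ⟨z, Subtype.ext hz⟩

theorem exists_tower_of_resolventDegree_le {F K L : Type u} [Field F] [Field K] [Algebra F K]
    [CommRing L] [Algebra K L] {m : ℕ} (h : resolventDegree F K L ≤ m) :
    ∃ (m' : ℕ∞) (E : Type u) (_ : Field E) (_ : Algebra F E) (_ : Algebra K E)
      (_ : IsScalarTower F K E), m' ≤ m ∧ IsTower F K E m' ∧ Nonempty (L →ₐ[K] E) := by
  have hne : {m : ℕ∞ | ∃ (E : Type u) (_ : Field E) (_ : Algebra F E) (_ : Algebra K E)
      (_ : IsScalarTower F K E), IsTower F K E m ∧ Nonempty (L →ₐ[K] E)}.Nonempty := by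
    by_contra hne
    rw [Set.not_nonempty_iff_eq_empty] at hne
    rw [resolventDegree, hne, sInf_empty] at h
    exact absurd h (by simp)
  obtain ⟨E, i1, i2, i3, i4, h1, h2⟩ := csInf_mem hne
  exact ⟨_, E, i1, i2, i3, i4, h, h1, h2⟩

end Towers

/-! ### Symmetric functions of transformed roots. -/

section Symmetric

open MvPolynomial

theorem algebraicIndependent_esymm {F Ω : Type u} [Field F] [Field Ω] [Algebra F Ω] {n : ℕ}
    {ζ : Fin n → Ω} (hζ : AlgebraicIndependent F ζ) :
    AlgebraicIndependent F fun k : Fin n => aeval ζ (esymm (Fin n) F (k + 1)) := by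
  have h : ∀ p : MvPolynomial (Fin n) F, aeval (fun k : Fin n => aeval ζ (esymm (Fin n) F (k + 1))) p
      = aeval ζ (esymmAlgHom (Fin n) F n p).val := by
    intro p
    rw [esymmAlgHom_apply, ← AlgHom.comp_apply, comp_aeval]
  intro p q hpq
  rw [h, h] at hpq
  exact esymmAlgHom_fin_injective F le_rfl (Subtype.ext (hζ hpq))

/-- An invertible linear change of variables is injective on polynomials; the inverse matrix
provides a left inverse. -/
theorem AlgebraicIndependent.mul_matrix {C Ω : Type u} [Field C] [Field Ω] [Algebra C Ω] {n : ℕ}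
    {b : Fin n → Ω} (hb : AlgebraicIndependent C b) (V : Matrix (Fin n) (Fin n) C)
    (hV : V.det ≠ 0) :
    AlgebraicIndependent C fun j => ∑ i, b i * algebraMap C Ω (V j i) := by
  let L (W : Matrix (Fin n) (Fin n) C) : MvPolynomial (Fin n) C →ₐ[C] MvPolynomial (Fin n) C :=
    aeval fun j => ∑ i, MvPolynomial.C (W j i) * X i
  have hL : (L V⁻¹).comp (L V) = AlgHom.id C _ := by
    refine MvPolynomial.algHom_ext fun j => ?_
    have h1 : V * V⁻¹ = 1 := Matrix.mul_nonsing_inv V (isUnit_iff_ne_zero.2 hV)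
    have h2 : ∀ k, ∑ i, V j i * V⁻¹ i k = (1 : Matrix (Fin n) (Fin n) C) j k := fun k => by
      rw [← h1, Matrix.mul_apply]
    simp only [L, AlgHom.comp_apply, aeval_X, map_sum, map_mul, algHom_C, algebraMap_eq,
      AlgHom.id_apply, Finset.mul_sum]
    rw [Finset.sum_comm]
    simp only [← mul_assoc, ← map_mul, ← Finset.sum_mul, ← map_sum, h2]
    simp [Matrix.one_apply, apply_ite]
  have hinj : Function.Injective (L V) := by
    intro p q hpq
    have := congrArg (L V⁻¹) hpq
    rwa [← AlgHom.comp_apply, ← AlgHom.comp_apply, hL] at this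
  have h : ∀ p, aeval (fun j => ∑ i, b i * algebraMap C Ω (V j i)) p = aeval b (L V p) := by
    intro p
    simp only [L]
    rw [← AlgHom.comp_apply, comp_aeval]
    congr 2
    funext j
    simp [mul_comm]
  intro p q hpq
  rw [h, h] at hpq
  exact hinj (hb hpq)

/-- Symmetric functions of the values of a polynomial at the roots of another one are rational. -/
theorem aeval_esymm_sum_pow_mem {F Ω : Type u} [Field F] [Field Ω] [Algebra F Ω] {n : ℕ}
    {N : IntermediateField F Ω} {θ b : Fin n → Ω} (hθ : ∀ k, aeval θ (esymm (Fin n) F k) ∈ N)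
    (hb : ∀ i, b i ∈ N) (k : ℕ) :
    aeval (fun j => ∑ i : Fin n, b i * θ j ^ (i : ℕ)) (esymm (Fin n) F k) ∈ N := by
  let g : Fin n → MvPolynomial (Fin n) N := fun j => ∑ i : Fin n, C ⟨b i, hb i⟩ * X j ^ (i : ℕ)
  -- Permuting the variables permutes the `g j`, so the fundamental theorem over `N` applies.
  have hsym : (aeval g (esymm (Fin n) F k)).IsSymmetric := by
    intro σ
    have h1 : rename σ (aeval g (esymm (Fin n) F k)) =
        aeval (fun j => g (σ j)) (esymm (Fin n) F k) := by
      rw [← AlgHom.coe_restrictScalars' F (rename (R := N) σ), ← AlgHom.comp_apply, comp_aeval]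
      congr 2
      funext j
      simp [g]
    rw [h1]
    conv_rhs => rw [← esymm_isSymmetric (Fin n) F k σ, aeval_rename]
    rfl
  obtain ⟨P, hP⟩ := esymmAlgHom_fin_surjective N le_rfl
    (⟨_, hsym⟩ : symmetricSubalgebra (Fin n) N)
  have h2 : aeval (fun j => ∑ i : Fin n, b i * θ j ^ (i : ℕ)) (esymm (Fin n) F k) =
      aeval θ (aeval g (esymm (Fin n) F k)) := by
    rw [← AlgHom.coe_restrictScalars' F (aeval (R := N) θ), ← AlgHom.comp_apply, comp_aeval]
    congr 2
    funext j
    simp only [g, AlgHom.coe_restrictScalars', map_sum, map_mul, map_pow, aeval_X, aeval_C]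
    rfl
  have h3 : aeval θ (aeval g (esymm (Fin n) F k)) =
      aeval (fun i : Fin n => aeval θ (esymm (Fin n) N (i + 1))) P := by
    have := congrArg Subtype.val hP
    rw [esymmAlgHom_apply] at this
    have this' : _ = aeval g (esymm (Fin n) F k) := this
    rw [← this', ← AlgHom.comp_apply, comp_aeval]
  have h4 : ∀ k, aeval θ (esymm (Fin n) N k) = aeval θ (esymm (Fin n) F k) := fun k => by
    rw [aeval_esymm_eq_multiset_esymm, aeval_esymm_eq_multiset_esymm]
  rw [h2, h3]
  simp only [h4]
  clear hP h3
  induction P using MvPolynomial.induction_on with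
  | C a =>
    rw [aeval_C]
    exact a.2
  | add p q hp hq =>
    rw [map_add]
    exact add_mem hp hq
  | mul_X p i hp =>
    rw [map_mul, aeval_X]
    exact mul_mem hp (hθ _)

end Symmetric

/-! ### Polynomials of degree at most `n` split over fields closed at level `RD F n`. -/

section RootsOfEsymm

variable {F Ω : Type u} [Field F] [Field Ω] [Algebra F Ω]

/-- The specialization of the general polynomial with prescribed roots. -/
theorem map_genericPoly_eq_prod {n : ℕ} (ζ : Fin n → Ω) (g : GenericField F n →ₐ[F] Ω)
    (hg : ∀ i : Fin n,
      g (algebraMap (MvPolynomial (Fin n) F) (GenericField F n) (MvPolynomial.X i)) =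
      MvPolynomial.aeval ζ (MvPolynomial.esymm (Fin n) F (i + 1))) :
    (genericPoly F n).map g.toRingHom =
      ∏ j, (Polynomial.X + Polynomial.C (ζ j)) := by
  have h1 := Multiset.prod_X_add_C_eq_sum_esymm (Finset.univ.val.map ζ)
  rw [Multiset.map_map, Multiset.card_map, Finset.card_val, Finset.card_univ, Fintype.card_fin,
    Finset.sum_range_succ', ← Fin.sum_univ_eq_sum_range
      (fun j => Polynomial.C ((Finset.univ.val.map ζ).esymm (j + 1)) *
        Polynomial.X ^ (n - (j + 1)))] at h1
  refine Eq.trans ?_ h1.symm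
  rw [genericPoly, Polynomial.map_add, Polynomial.map_pow, Polynomial.map_X, Polynomial.map_sum,
    add_comm]
  congr 1
  · refine Finset.sum_congr rfl fun i _ => ?_
    rw [Polynomial.map_mul, Polynomial.map_pow, Polynomial.map_X, Polynomial.map_C]
    congr 2
    · rw [← MvPolynomial.aeval_esymm_eq_multiset_esymm (Fin n) F]
      exact hg i
    · omega
  · simp [Multiset.esymm]

/-- A field that is closed under extensions of essential dimension at most `RD(n)` contains
generic elements as soon as it contains their elementary symmetric functions. -/
theorem mem_of_aeval_esymm_mem [IsAlgClosed Ω] {m n : ℕ} {N : IntermediateField F Ω}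
    (hN : IsRDClosedIn m N) (hRD : RD F n ≤ m) {ζ : Fin n → Ω} (hζ : AlgebraicIndependent F ζ)
    (hmem : ∀ k, MvPolynomial.aeval ζ (MvPolynomial.esymm (Fin n) F k) ∈ N) (j : Fin n) :
    ζ j ∈ N := by
  have hn : 1 ≤ n := by have := j.2; omega
  -- The generic coefficients go to the elementary symmetric functions of `ζ`. These are
  -- algebraically independent, so the map extends to the fraction field; the roots become `-ζ j`.
  let e : MvPolynomial (Fin n) F →ₐ[F] Ω := MvPolynomial.aeval fun k : Fin n =>
    MvPolynomial.aeval ζ (MvPolynomial.esymm (Fin n) F (k + 1))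
  have he : Function.Injective e := algebraicIndependent_esymm hζ
  let g : GenericField F n →ₐ[F] Ω := IsFractionRing.liftAlgHom (g := e) he
  have hge : ∀ p, g (algebraMap _ _ p) = e p := fun p => IsFractionRing.lift_algebraMap he p
  have hgX : ∀ i : Fin n, g (algebraMap _ _ (MvPolynomial.X i)) =
      MvPolynomial.aeval ζ (MvPolynomial.esymm (Fin n) F (i + 1)) := fun i => by
    rw [hge]
    exact MvPolynomial.aeval_X _ i
  have heN : ∀ p, e p ∈ N := by
    intro p
    induction p using MvPolynomial.induction_on with
    | C a =>
      rw [MvPolynomial.algHom_C]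
      exact N.algebraMap_mem a
    | add p q hp hq =>
      rw [map_add]
      exact add_mem hp hq
    | mul_X p i hp =>
      rw [map_mul]
      refine mul_mem hp ?_
      rw [← hge, hgX]
      exact hmem _
  have hgN : ∀ x, g x ∈ N := by
    intro x
    obtain ⟨p, q, -, rfl⟩ := IsFractionRing.div_surjective (A := MvPolynomial (Fin n) F) x
    rw [map_div₀, hge, hge]
    exact div_mem (heN p) (heN q)
  have hmap := map_genericPoly_eq_prod ζ g hgX
  obtain ⟨m', E, i1, i2, i3, i4, hm', hE, ⟨ψ⟩⟩ := exists_tower_of_resolventDegree_le hRD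
  let : Algebra (GenericField F n) Ω := g.toRingHom.toAlgebra
  have : IsScalarTower F (GenericField F n) Ω := .of_algebraMap_eq fun r => (g.commutes r).symm
  have hEalg := hE.isAlgebraic
  let r : E := ψ (AdjoinRoot.root (genericPoly F n))
  have hr : Polynomial.aeval r (genericPoly F n) = 0 := by
    rw [Polynomial.aeval_algHom_apply, AdjoinRoot.aeval_eq, AdjoinRoot.mk_self, map_zero]
  have hmonic : (genericPoly F n).Monic := by
    rw [← map_genericPolyInt]
    exact (monic_genericPolyInt F n).map _
  have hmin : genericPoly F n = minpoly (GenericField F n) r :=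
    minpoly.eq_of_irreducible_of_monic (irreducible_genericPoly F hn) hr hmonic
  have hroot : Polynomial.aeval (-ζ j) (minpoly (GenericField F n) r) = 0 := by
    rw [← hmin, ← Polynomial.eval_map_algebraMap]
    refine (congrArg (Polynomial.eval (-ζ j)) hmap).trans ?_
    rw [Polynomial.eval_prod]
    exact Finset.prod_eq_zero (Finset.mem_univ j) (by simp)
  -- Irreducibility allows the embedding of the tower to send its distinguished root to any chosen
  -- `-ζ j`.
  obtain ⟨φ, hφ⟩ := IntermediateField.exists_algHom_of_splits_of_aeval
    (fun s : E => ⟨Algebra.IsIntegral.isIntegral s, IsAlgClosed.splits _⟩) hroot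
  have h1 := hE.map_le hm' hN (φ.restrictScalars F) (fun x => by
    have : φ (algebraMap _ E x) = g x := φ.commutes x
    change φ (algebraMap _ E x) ∈ N
    rw [this]
    exact hgN x) r
  have h2 : -ζ j ∈ N := by
    rw [← hφ]
    exact h1
  exact neg_mem_iff.1 h2

/-- Distinct elements of an algebraically closed field lie in every subfield that is closed under
extensions of essential dimension at most `RD(n)` and contains their elementary symmetric
functions. -/
theorem mem_of_aeval_esymm_mem_of_injective [Infinite F] {C : Type u} [Field C] [Algebra F C]
    [IsAlgClosed C] {m n : ℕ} {M : IntermediateField F C} (hM : IsRDClosedIn m M)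
    (hRD : RD F n ≤ m) (hn : 2 ≤ n) {θ : Fin n → C} (hθ : Function.Injective θ)
    (hmem : ∀ k, MvPolynomial.aeval θ (MvPolynomial.esymm (Fin n) F k) ∈ M) (j : Fin n) :
    θ j ∈ M := by
  let B := MvPolynomial (Fin n) C
  let Q := FractionRing B
  let Ω := AlgebraicClosure Q
  have hinj : Function.Injective (algebraMap B Ω) := by
    rw [IsScalarTower.algebraMap_eq B Q Ω]
    exact (algebraMap Q Ω).injective.comp (IsFractionRing.injective B Q)
  have halg : Algebra.IsAlgebraic B Ω :=
    (IsFractionRing.comap_isAlgebraic_iff (A := B) (K := Q) (C := Ω)).2 inferInstance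
  let b : Fin n → Ω := fun i => algebraMap B Ω (MvPolynomial.X i)
  have hb : AlgebraicIndependent C b :=
    (MvPolynomial.algebraicIndependent_X (Fin n) C).map' (f := Algebra.ofId B Ω |>.restrictScalars C)
      hinj
  let N : IntermediateField F Ω := specField M b
  have hN : IsRDClosedIn m N := isRDClosedIn_specField hM
  have hbN : ∀ i, b i ∈ N := fun i => apply_mem_specField i
  let θ' : Fin n → Ω := fun k => algebraMap C Ω (θ k)
  have hθ' : ∀ k, MvPolynomial.aeval θ' (MvPolynomial.esymm (Fin n) F k) ∈ N := by
    intro k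
    have h1 : MvPolynomial.aeval θ' (MvPolynomial.esymm (Fin n) F k) =
        algebraMap C Ω (MvPolynomial.aeval θ (MvPolynomial.esymm (Fin n) F k)) :=
      MvPolynomial.aeval_algebraMap_apply _ _ _
    rw [h1]
    exact algebraMap_mem_specField (hmem k)
  -- Tschirnhaus transformation with generic coefficients: the new roots are independent because the
  -- Vandermonde matrix of the distinct `θ` is invertible, and their symmetric functions lie in `N`.
  have key : ∀ σ : Equiv.Perm (Fin n), ∑ i, b (σ i) * θ' j ^ (i : ℕ) ∈ N := by
    intro σ
    have h1 := AlgebraicIndependent.mul_matrix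
      (hb.comp σ σ.injective) (Matrix.vandermonde θ) (Matrix.det_vandermonde_ne_zero_iff.2 hθ)
    have h2 := (h1.restrictScalars (algebraMap F C).injective : AlgebraicIndependent F _)
    have e : (fun j : Fin n => ∑ i, (b ∘ σ) i * algebraMap C Ω (Matrix.vandermonde θ j i)) =
        fun j : Fin n => ∑ i : Fin n, b (σ i) * θ' j ^ (i : ℕ) := by
      funext j
      simp [Matrix.vandermonde_apply, θ']
    rw [e] at h2
    exact mem_of_aeval_esymm_mem hN hRD h2
      (fun k => aeval_esymm_sum_pow_mem hθ' (fun i => hbN (σ i)) k) j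
  let i0 : Fin n := ⟨0, by omega⟩
  let i1 : Fin n := ⟨1, by omega⟩
  have h01 : i0 ≠ i1 := by simp [i0, i1]
  -- Exchanging the first two coefficients isolates `θ j`; this is where two coefficients, hence `n
  -- ≥ 2`, are needed.
  have hdiff : ∑ i, b i * θ' j ^ (i : ℕ) - ∑ i, b (Equiv.swap i0 i1 i) * θ' j ^ (i : ℕ) =
      (b i0 - b i1) * (1 - θ' j) := by
    rw [← Finset.sum_sub_distrib, Finset.sum_eq_add i0 i1 h01]
    · rw [Equiv.swap_apply_left, Equiv.swap_apply_right]
      simp only [i0, i1]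
      ring
    · rintro i - ⟨h0, h1⟩
      rw [Equiv.swap_apply_of_ne_of_ne h0 h1, sub_self]
    · simp
    · simp
  have hb01 : b i0 - b i1 ≠ 0 := sub_ne_zero.2 fun h => h01 (hb.injective h)
  have hθN : θ' j ∈ N := by
    have h1 : (b i0 - b i1) * (1 - θ' j) ∈ N := by
      rw [← hdiff]
      exact sub_mem (key (Equiv.refl _)) (key _)
    have h2 : 1 - θ' j ∈ N := by
      rw [← mul_div_cancel_left₀ (1 - θ' j) hb01]
      exact div_mem h1 (sub_mem (hbN _) (hbN _))
    have := sub_mem (one_mem N) h2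
    rwa [sub_sub_cancel] at this
  obtain ⟨T, hT⟩ := mem_specField.1 hθN
  obtain ⟨h, h0, hspec⟩ := exists_algHom_specialization (C := C) hinj T
  -- Since `F` is infinite, the `b i` can be specialized to values in `F ⊆ M` off the zero set of
  -- `h`. The specialization fixes `C`, so it returns `θ j` itself.
  obtain ⟨β, hβ⟩ : ∃ β : Fin n → F, MvPolynomial.eval (fun i => algebraMap F C (β i)) h ≠ 0 := by
    by_contra! hall
    refine h0 (MvPolynomial.funext_set (fun _ => Set.range (algebraMap F C))
      (fun _ => Set.infinite_range_of_injective (algebraMap F C).injective) fun x hx => ?_)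
    choose β hβ using fun i => hx i (Set.mem_univ i)
    rw [map_zero, ← hall β]
    congr 2
    funext i
    exact (hβ i).symm
  obtain ⟨R, φ, hTR, hφ⟩ := hspec (MvPolynomial.aeval fun i => algebraMap F C (β i)) hβ
  obtain ⟨h1, h2⟩ := hT R φ hTR fun i => by
    obtain ⟨h1, h2⟩ := hφ (MvPolynomial.X i)
    refine ⟨h1, ?_⟩
    rw [h2, MvPolynomial.aeval_X]
    exact M.algebraMap_mem _
  have h3 : φ ⟨θ' j, h1⟩ = θ j := φ.commutes (θ j)
  rwa [h3] at h2

theorem aeval_esymm_mem_of_coeff_mem {n : ℕ} {N : IntermediateField F Ω} (θ : Fin n → Ω)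
    (h : ∀ k, (∏ j, (Polynomial.X - Polynomial.C (θ j))).coeff k ∈ N) (k : ℕ) :
    MvPolynomial.aeval θ (MvPolynomial.esymm (Fin n) F k) ∈ N := by
  rw [MvPolynomial.aeval_esymm_eq_multiset_esymm]
  have hcard : Multiset.card (Finset.univ.val.map θ) = n := by simp
  by_cases hk : k ≤ n
  · have h1 := Multiset.prod_X_sub_C_coeff (Finset.univ.val.map θ) (k := n - k) (by omega)
    rw [Multiset.map_map, hcard, Nat.sub_sub_self hk] at h1
    have h2 : (-1) ^ k * (Finset.univ.val.map θ).esymm k ∈ N := by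
      rw [← h1]
      exact h (n - k)
    have h3 := mul_mem (pow_mem (neg_mem (one_mem N)) k) h2
    rwa [← mul_assoc, ← mul_pow, neg_one_mul, neg_neg, one_pow, one_mul] at h3
  · rw [Multiset.esymm, Multiset.powersetCard_eq_empty _ (by omega)]
    simp

/-- Over a field that is closed under extensions of essential dimension at most `RD(n)`, polynomials
of degree at most `n` split. -/
theorem IsRDClosed.splits_of_natDegree_le [CharZero F] {M : Type u} [Field M] [Algebra F M]
    {m n : ℕ} (hM : IsRDClosed F m M) (hRD : RD F n ≤ m) (hn : 2 ≤ n) (p : Polynomial M)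
    (hp : p.natDegree ≤ n) : p.Splits := by
  classical
  have : CharZero M := charZero_of_injective_algebraMap (algebraMap F M).injective
  by_cases hp0 : p = 0
  · rw [hp0]
    exact Polynomial.Splits.zero
  let C := AlgebraicClosure M
  refine Polynomial.Splits.of_splits_map (algebraMap M C) (IsAlgClosed.splits _) fun y hy => ?_
  let q := minpoly M y
  have hy0 : Polynomial.aeval y p = 0 := by
    rw [Polynomial.mem_roots (Polynomial.map_ne_zero hp0), Polynomial.IsRoot.def,
      Polynomial.eval_map_algebraMap] at hy
    exact hy
  have hint : IsIntegral M y := Algebra.IsIntegral.isIntegral y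
  have hqn : q.natDegree ≤ n := (Polynomial.natDegree_le_of_dvd (minpoly.dvd M y hy0) hp0).trans hp
  have hq0 : q ≠ 0 := minpoly.ne_zero hint
  have hsep : q.Separable := (minpoly.irreducible hint).separable
  -- The roots of the separable polynomial `q` are padded by elements of `M` that are not roots,
  -- giving exactly `n` distinct elements.
  obtain ⟨A, hA, hAcard⟩ := (Set.Infinite.sdiff (Set.infinite_univ (α := M))
    (Multiset.toFinset q.roots).finite_toSet).exists_subset_card_eq (n - q.natDegree)
  have hqs : (q.map (algebraMap M C)).Splits := IsAlgClosed.splits _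
  have hnodup : (q.aroots C).Nodup :=
    (Polynomial.nodup_aroots_iff_of_splits hq0 hqs).2 hsep
  let R : Finset C := ⟨q.aroots C, hnodup⟩
  have hRcard : R.card = q.natDegree := by
    rw [← Polynomial.natDegree_map (algebraMap M C), hqs.natDegree_eq_card_roots]
    rfl
  have hdisj : Disjoint R (A.image (algebraMap M C)) := by
    refine Finset.disjoint_right.2 fun z hz hzR => ?_
    obtain ⟨a, ha, rfl⟩ := Finset.mem_image.1 hz
    have h1 : Polynomial.aeval (algebraMap M C a) q = 0 := (Polynomial.mem_aroots.1 hzR).2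
    rw [Polynomial.aeval_algebraMap_apply, map_eq_zero] at h1
    refine (hA ha).2 ?_
    rw [Finset.mem_coe, Multiset.mem_toFinset, Polynomial.mem_roots hq0]
    exact h1
  let S : Finset C := R ∪ A.image (algebraMap M C)
  have hScard : S.card = n := by
    rw [Finset.card_union_of_disjoint hdisj, hRcard,
      Finset.card_image_of_injective _ (algebraMap M C).injective, hAcard]
    omega
  let e : Fin n ≃ S := (S.equivFinOfCardEq hScard).symm
  let θ : Fin n → C := fun j => e j
  have hprod : ∏ j, (Polynomial.X - Polynomial.C (θ j)) =
      (q * ∏ a ∈ A, (Polynomial.X - Polynomial.C a)).map (algebraMap M C) := by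
    have h1 : ∏ j, (Polynomial.X - Polynomial.C (θ j)) =
        ∏ x ∈ S, (Polynomial.X - Polynomial.C x) := by
      rw [← Finset.prod_coe_sort S]
      exact e.prod_comp fun x : S => (Polynomial.X - Polynomial.C x.1)
    rw [h1, Finset.prod_union hdisj, Finset.prod_image fun a _ a' _ h =>
      (algebraMap M C).injective h, Polynomial.map_mul, Polynomial.map_prod]
    congr 1
    · exact (hqs.eq_prod_roots_of_monic ((minpoly.monic hint).map _)).symm
    · simp
  let ι : M →ₐ[F] C := IsScalarTower.toAlgHom F M C
  have hmem := aeval_esymm_mem_of_coeff_mem (N := ι.fieldRange) θ fun k => by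
    rw [hprod, Polynomial.coeff_map]
    exact ⟨_, rfl⟩
  have hyR : y ∈ S := Finset.mem_union_left _
    ((Polynomial.mem_aroots (S := C)).2 ⟨hq0, minpoly.aeval M y⟩)
  have h2 := mem_of_aeval_esymm_mem_of_injective (hM.fieldRange ι) hRD hn
    (Subtype.val_injective.comp e.injective) hmem (e.symm ⟨y, hyR⟩)
  have h3 : θ (e.symm ⟨y, hyR⟩) = y := by simp [θ]
  obtain ⟨x, hx⟩ := h2
  exact ⟨x, hx.trans h3⟩

end RootsOfEsymm

/-! ### Finiteness and monotonicity of `RD`. -/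

section Monotone

theorem resolventDegree_le_of_algHom {F K L L' : Type u} [Field F] [Field K] [Algebra F K]
    [CommRing L] [Algebra K L] [CommRing L'] [Algebra K L'] (φ : L →ₐ[K] L') :
    resolventDegree F K L ≤ resolventDegree F K L' := by
  refine sInf_le_sInf ?_
  rintro m ⟨E, i1, i2, i3, i4, hE, ⟨ψ⟩⟩
  exact ⟨E, i1, i2, i3, i4, hE, ⟨ψ.comp φ⟩⟩

variable {F : Type u} [Field F]

theorem monic_genericPoly (n : ℕ) : (genericPoly F n).Monic := by
  rw [← map_genericPolyInt]
  exact (monic_genericPolyInt F n).map _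

theorem natDegree_genericPoly (n : ℕ) : (genericPoly F n).natDegree = n := by
  rw [← map_genericPolyInt, (monic_genericPolyInt F n).natDegree_map, natDegree_genericPolyInt]

/-- A root in the closure lies in an extension of resolvent degree at most `m`, into which
`AdjoinRoot` then maps. -/
theorem RD_le_of_mem_rdClosure {Ω : Type u} [Field Ω] [Algebra F Ω] {n m : ℕ}
    [Algebra (GenericField F n) Ω] [IsScalarTower F (GenericField F n) Ω] {y : Ω}
    (hy : Polynomial.aeval y (genericPoly F n) = 0)
    (hmem : y ∈ rdClosure m (IsScalarTower.toAlgHom F (GenericField F n) Ω).fieldRange) :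
    RD F n ≤ m := by
  obtain ⟨K', i1, i2, hK', φ, hφ, -⟩ := exists_resolventDegree_le (K := GenericField F n) {y}
    (by simpa using hmem)
  obtain ⟨x, hx⟩ : y ∈ Set.range φ := hφ (by simp)
  have hx0 : Polynomial.aeval x (genericPoly F n) = 0 := by
    refine φ.toRingHom.injective ?_
    rw [map_zero]
    refine Eq.trans ?_ hy
    rw [← hx, Polynomial.aeval_algHom_apply]
    rfl
  exact (resolventDegree_le_of_algHom (AdjoinRoot.liftAlgHom _ (Algebra.ofId _ K') x hx0)).trans hK'

/-- The resolvent degree of the general polynomial is finite. -/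
theorem RD_le {n : ℕ} (hn : 1 ≤ n) : RD F n ≤ n := by
  classical
  let Ω := AlgebraicClosure (GenericField F n)
  obtain ⟨y, hy⟩ := IsAlgClosed.exists_aeval_eq_zero Ω (genericPoly F n) (by
    rw [Polynomial.degree_eq_natDegree (monic_genericPoly n).ne_zero, natDegree_genericPoly]
    exact_mod_cast (by omega : n ≠ 0))
  refine RD_le_of_mem_rdClosure hy ?_
  let a : Fin n → Ω := fun i =>
    algebraMap (GenericField F n) Ω (algebraMap _ _ (MvPolynomial.X i : MvPolynomial (Fin n) F))
  -- The `n` generic coefficients serve as the parameters of a single adjunction.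
  refine isRDClosedIn_rdClosure (Finset.univ.image a)
    (Finset.card_image_le.trans (by simp)) (fun z hz => ?_) y
    (isAlgebraic_adjoin_iff_exists.2 ⟨(genericPoly F n).map (algebraMap _ Ω),
      Polynomial.map_ne_zero (monic_genericPoly n).ne_zero, fun k => ?_, ?_⟩)
  · obtain ⟨i, -, rfl⟩ := Finset.mem_image.1 (Finset.mem_coe.1 hz)
    exact le_rdClosure ⟨_, rfl⟩
  · have h1 : ∀ p : MvPolynomial (Fin n) F, algebraMap (GenericField F n) Ω (algebraMap _ _ p) ∈
        Algebra.adjoin F ((Finset.univ.image a : Finset Ω) : Set Ω) := by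
      intro p
      have h2 : algebraMap (GenericField F n) Ω (algebraMap _ _ p) = MvPolynomial.aeval a p := by
        have h3 : ((Algebra.ofId (GenericField F n) Ω).restrictScalars F).comp
            (Algebra.algHom F (MvPolynomial (Fin n) F) (GenericField F n)) =
              MvPolynomial.aeval a :=
          MvPolynomial.algHom_ext fun i => by
            rw [MvPolynomial.aeval_X]
            rfl
        exact congrArg (fun f => f p) h3
      rw [h2, Finset.coe_image, Finset.coe_univ, Set.image_univ,
        Algebra.adjoin_range_eq_range_aeval]
      exact ⟨p, rfl⟩
    rw [← map_genericPolyInt, Polynomial.coeff_map, Polynomial.coeff_map]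
    exact h1 _
  · rw [Polynomial.eval_map_algebraMap]
    exact hy

theorem exists_RD_eq {n : ℕ} (hn : 1 ≤ n) : ∃ m : ℕ, RD F n = m := by
  obtain ⟨m, hm⟩ := ENat.ne_top_iff_exists.1
    (ne_top_of_le_ne_top (ENat.natCast_ne_top n) (RD_le (F := F) hn))
  exact ⟨m, hm.symm⟩

/-- The resolvent degree of the general polynomial is monotone in the degree. -/
theorem RD_mono [CharZero F] {n n' : ℕ} (hn : 1 ≤ n) (hn' : 2 ≤ n') (h : n ≤ n') :
    RD F n ≤ RD F n' := by
  obtain ⟨m, hm⟩ := exists_RD_eq (F := F) (by omega : 1 ≤ n')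
  rw [hm]
  let Ω := AlgebraicClosure (GenericField F n)
  let N : IntermediateField F Ω :=
    rdClosure m (IsScalarTower.toAlgHom F (GenericField F n) Ω).fieldRange
  have hN : IsRDClosedIn m N := isRDClosedIn_rdClosure
  let j : GenericField F n →ₐ[F] N :=
    (IsScalarTower.toAlgHom F (GenericField F n) Ω).codRestrict N.toSubalgebra
      fun x => le_rdClosure ⟨x, rfl⟩
  have hdeg : ((genericPoly F n).map j.toRingHom).natDegree = n := by
    rw [(monic_genericPoly n).natDegree_map, natDegree_genericPoly]
  -- At level `RD F n'` all polynomials of degree at most `n'` split, among them the general one of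
  -- degree `n`.
  have hsplit := hN.isRDClosed.splits_of_natDegree_le hm.le hn' _ (hdeg.le.trans h)
  obtain ⟨x, hx⟩ := hsplit.exists_eval_eq_zero (by
    rw [Polynomial.degree_eq_natDegree ((monic_genericPoly n).map _).ne_zero, hdeg]
    exact_mod_cast (by omega : n ≠ 0))
  refine RD_le_of_mem_rdClosure (y := (x : Ω)) ?_ x.2
  rw [Polynomial.eval_map] at hx
  have h1 := Polynomial.hom_eval₂ (genericPoly F n) j.toRingHom (algebraMap N Ω) x
  rw [hx, map_zero] at h1
  exact h1.symm

end Monotone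

/-! ### Flats under field extension and descent. -/

section Transport

open MvPolynomial

theorem aeval_algebraMap_comp {K L M : Type u} [Field K] [Field L] [Field M] [Algebra K L]
    [Algebra L M] [Algebra K M] [IsScalarTower K L M] {n : ℕ} (P : Fin n → L)
    (f : MvPolynomial (Fin n) K) :
    aeval (fun a => algebraMap L M (P a)) f = algebraMap L M (aeval P f) :=
  aeval_algebraMap_apply M P f

/-- Flats on which polynomials vanish persist under extension of the field. -/
theorem exists_flat_extension {L M : Type u} [Field L] [Infinite L] [Field M] [Algebra L M]
    {n k : ℕ} (W : Submodule L (Fin n → L)) (hW : Module.finrank L W = k) :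
    ∃ W' : Submodule M (Fin n → M), Module.finrank M W' = k ∧ ∀ g : MvPolynomial (Fin n) L,
      (∀ P ∈ W, eval P g = 0) → ∀ P ∈ W', aeval P g = 0 := by
  let b := Module.finBasisOfFinrankEq L W hW
  let v : Fin k → Fin n → L := fun i => b i
  have hv : LinearIndependent L v :=
    b.linearIndependent.map' W.subtype (Submodule.ker_subtype W)
  have hv' : LinearIndependent M fun i => algebraMap L M ∘ v i :=
    linearIndependent_algebraMap_comp_iff.2 hv
  refine ⟨Submodule.span M (Set.range fun i => algebraMap L M ∘ v i),
    (finrank_span_eq_card hv').trans (Fintype.card_fin k), fun g hg P hP => ?_⟩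
  obtain ⟨c, rfl⟩ := (Submodule.mem_span_range_iff_exists_fun M).1 hP
  -- `G` is `g` in the parameters of the flat. It vanishes at all `L`-points, so it is zero as `L`
  -- is infinite, and then vanishes at `M`-points too.
  let G : MvPolynomial (Fin k) L := aeval (fun a => ∑ i, X i * C (v i a)) g
  have hG : G = 0 := by
    refine MvPolynomial.funext fun x => ?_
    have h1 : eval x G = eval (∑ i, x i • v i) g := by
      rw [eval_aeval_eq]
      congr 2
      funext a
      simp [Finset.sum_apply]
    rw [h1, map_zero]
    exact hg _ (sum_mem fun i _ => W.smul_mem _ (b i).2)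
  have h2 : aeval c G = aeval (∑ i, c i • (algebraMap L M ∘ v i)) g := by
    rw [← AlgHom.comp_apply, comp_aeval]
    congr 2
    funext a
    simp [Finset.sum_apply]
  rw [← h2, hG, map_zero]

/-- Flats descend along extensions that contain the coordinates of a basis. -/
theorem exists_flat_descent {L M : Type u} [Field L] [Field M] [Algebra L M]
    {n k : ℕ} {W : Submodule M (Fin n → M)} (b : Module.Basis (Fin k) M W)
    (Q : Fin k → Fin n → L) (hQ : ∀ i a, algebraMap L M (Q i a) = (b i : Fin n → M) a) :
    ∃ W' : Submodule L (Fin n → L), Module.finrank L W' = k ∧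
      ∀ P ∈ W', (fun a => algebraMap L M (P a)) ∈ W := by
  have hli : LinearIndependent L Q := by
    refine (linearIndependent_algebraMap_comp_iff (S := M)).1 ?_
    have h1 := b.linearIndependent.map' W.subtype (Submodule.ker_subtype W)
    have e : (fun i => algebraMap L M ∘ Q i) = W.subtype ∘ b :=
      _root_.funext fun i => _root_.funext fun a => hQ i a
    rwa [e]
  refine ⟨Submodule.span L (Set.range Q), (finrank_span_eq_card hli).trans (Fintype.card_fin k),
    fun P hP => ?_⟩
  obtain ⟨c, rfl⟩ := (Submodule.mem_span_range_iff_exists_fun L).1 hP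
  have h1 : (fun a => algebraMap L M ((∑ i, c i • Q i) a)) =
      ∑ i, algebraMap L M (c i) • (b i : Fin n → M) := by
    funext a
    simp [Finset.sum_apply, hQ, Algebra.smul_def]
  rw [h1]
  exact sum_mem fun i _ => W.smul_mem _ (b i).2

end Transport

/-! ### Determinability is existence over closed fields. -/

section CanDetermine

variable (F : Type u) [Field F]

/-- Over every finitely generated field `K`, every system of type `(d; ℓ_d, …, ℓ_1)` in `n` variables
vanishes on a `k`-dimensional subspace over an extension `K' / K` with `RD(K' / K) ≤ RD(d)`. -/
def CanDetermineFlat (k d : ℕ) (ℓ : ℕ → ℕ) (n : ℕ) : Prop :=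
  ∀ (K : Type u) [Field K] [Algebra F K], (⊤ : IntermediateField F K).FG →
    ∀ f : (j : ℕ) → Fin (ℓ j) → MvPolynomial (Fin n) K, IsSystem n d ℓ f →
      ∃ (K' : Type u) (_ : Field K') (_ : Algebra K K'), resolventDegree F K K' ≤ RD F d ∧
        ∃ W : Submodule K' (Fin n → K'), Module.finrank K' W = k ∧ ∀ P ∈ W, IsSolution d f P

variable {F}

/-- The flat is found over the closure of `K` in an algebraic closure. The coordinates of a basis
are finitely many, so it descends to an extension of resolvent degree at most `m`. -/
theorem canDetermineFlat_of_hasFlat {k d m n : ℕ} {ℓ : ℕ → ℕ} (hm : RD F d = m)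
    (h : ∀ (M : Type u) [Field M] [Algebra F M], IsRDClosed F m M → HasFlat M k d ℓ n) :
    CanDetermineFlat F k d ℓ n := by
  classical
  intro K _ _ _ f hf
  let Ω := AlgebraicClosure K
  let N : IntermediateField F Ω := rdClosure m (IsScalarTower.toAlgHom F K Ω).fieldRange
  let j : K →ₐ[F] N := (IsScalarTower.toAlgHom F K Ω).codRestrict N.toSubalgebra
    fun x => le_rdClosure ⟨x, rfl⟩
  let : Algebra K N := j.toRingHom.toAlgebra
  obtain ⟨W, hW, hWf⟩ := h N isRDClosedIn_rdClosure.isRDClosed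
    (fun i => Finset.univ.image fun a => MvPolynomial.map (algebraMap K N) (f i a))
    fun i hi => ⟨Finset.card_image_le.trans (by simp), fun g hg => by
      obtain ⟨a, -, rfl⟩ := Finset.mem_image.1 hg
      exact (hf i hi a).map _⟩
  let b := Module.finBasisOfFinrankEq N W hW
  obtain ⟨K', i1, i2, hK', φ, hφ, hφN⟩ := exists_resolventDegree_le (F := F) (K := K) (m := m)
    (Finset.univ.image fun x : Fin k × Fin n => (((b x.1 : Fin n → N) x.2 : N) : Ω)) fun z hz => by
      obtain ⟨x, -, rfl⟩ := Finset.mem_image.1 (Finset.mem_coe.1 hz)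
      exact ((b x.1 : Fin n → N) x.2).2
  let φN : K' →+* N := φ.toRingHom.codRestrict N hφN
  let : Algebra K' N := φN.toAlgebra
  have : IsScalarTower K K' N := .of_algebraMap_eq fun x => Subtype.ext (φ.commutes x).symm
  have hQ : ∀ i a, ∃ x : K', algebraMap K' N x = (b i : Fin n → N) a := fun i a => by
    obtain ⟨x, hx⟩ := hφ (Finset.mem_coe.2 (Finset.mem_image_of_mem _ (Finset.mem_univ (i, a))))
    exact ⟨x, Subtype.ext hx⟩
  choose Q hQ using hQ
  obtain ⟨W', hW', hW'W⟩ := exists_flat_descent b Q hQ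
  refine ⟨K', i1, i2, hK'.trans hm.ge, W', hW', fun P hP i hi a => ?_⟩
  refine (algebraMap K' N).injective ?_
  rw [← aeval_algebraMap_comp, map_zero, MvPolynomial.aeval_def, ← MvPolynomial.eval_map]
  exact hWf _ (hW'W P hP) i hi _ (Finset.mem_image_of_mem _ (Finset.mem_univ a))

/-- Extensions of resolvent degree at most `m` embed into closed fields. -/
theorem IsRDClosed.nonempty_algHom {K L M : Type u} [Field K] [Algebra F K] [Field L] [Algebra K L]
    [Field M] [Algebra F M] [Algebra K M] [IsScalarTower F K M] {m : ℕ} (hM : IsRDClosed F m M)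
    (h : resolventDegree F K L ≤ m) : Nonempty (L →ₐ[K] M) := by
  obtain ⟨m', E, j1, j2, j3, j4, hm', hE, ⟨ψ⟩⟩ := exists_tower_of_resolventDegree_le h
  let Ω := AlgebraicClosure M
  have hEalg := hE.isAlgebraic
  let ι : E →ₐ[K] Ω := IsAlgClosed.lift
  let κ : M →ₐ[K] Ω := IsScalarTower.toAlgHom K M Ω
  have hEN := hE.map_le hm' (hM.fieldRange (κ.restrictScalars F)) (ι.restrictScalars F) fun x =>
    ⟨algebraMap K M x, (κ.commutes x).trans (ι.commutes x).symm⟩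
  let e : M ≃ₐ[K] κ.fieldRange := AlgEquiv.ofInjectiveField κ
  exact ⟨(e.symm : κ.fieldRange →ₐ[K] M).comp
    ((ι.codRestrict κ.fieldRange.toSubalgebra hEN).comp ψ)⟩

/-- The coefficients of the forms generate a finitely generated field `K` inside `M`; the extension
determined over `K` embeds into `M`, and the flat is carried along. -/
theorem CanDetermineFlat.hasFlat [CharZero F] {k d m n : ℕ} {ℓ : ℕ → ℕ} (hm : RD F d ≤ m)
    (h : CanDetermineFlat F k d ℓ n) {M : Type u} [Field M] [Algebra F M] (hM : IsRDClosed F m M) :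
    HasFlat M k d ℓ n := by
  classical
  intro S hS
  let s : Finset M := (Finset.Icc 1 d).biUnion fun j => (S j).biUnion MvPolynomial.coeffs
  let K := IntermediateField.adjoin F (s : Set M)
  have hFG : (⊤ : IntermediateField F K).FG := by
    have := IntermediateField.essFiniteType_iff.2 (IntermediateField.fg_adjoin_finset (F := F) s)
    exact IntermediateField.fg_top F K
  -- The sets `S j` are listed as `ℓ j` forms, padded by zeros; degrees outside the range also get
  -- zeros.
  have hex : ∀ j (a : Fin (ℓ j)), ∃ g : MvPolynomial (Fin n) K, j ∈ Finset.Icc 1 d →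
      if h : a.1 < (S j).card then MvPolynomial.map (algebraMap K M) g =
        (S j).equivFin.symm ⟨a.1, h⟩ else g = 0 := by
    intro j a
    by_cases hj : j ∈ Finset.Icc 1 d
    · by_cases ha : a.1 < (S j).card
      · obtain ⟨g, hg⟩ := MvPolynomial.mem_range_map_iff_coeffs_subset (f := algebraMap K M)
          (x := ((S j).equivFin.symm ⟨a.1, ha⟩).1) |>.2 fun c hc =>
            ⟨⟨c, IntermediateField.subset_adjoin F _ (Finset.mem_coe.2 (Finset.mem_biUnion.2
              ⟨j, hj, Finset.mem_biUnion.2 ⟨_, ((S j).equivFin.symm ⟨a.1, ha⟩).2, hc⟩⟩))⟩, rfl⟩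
        exact ⟨g, fun _ => by rwa [dif_pos ha]⟩
      · exact ⟨0, fun _ => by rw [dif_neg ha]⟩
    · exact ⟨0, fun h => absurd h hj⟩
  choose f hf using hex
  have hsys : IsSystem n d ℓ f := by
    intro j hj a
    have h1 := hf j a hj
    split_ifs at h1 with ha
    · have h2 := (hS j hj).2 _ ((S j).equivFin.symm ⟨a.1, ha⟩).2
      rw [← h1] at h2
      intro c hc
      refine h2 ?_
      rw [MvPolynomial.coeff_map]
      exact (map_ne_zero _).2 hc
    · rw [h1]
      exact MvPolynomial.isHomogeneous_zero _ _ _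
  obtain ⟨K', i1, i2, hK', W, hW, hWf⟩ := h K hFG f hsys
  obtain ⟨φ⟩ := hM.nonempty_algHom (hK'.trans hm)
  let : Algebra K' M := φ.toRingHom.toAlgebra
  have : IsScalarTower K K' M := .of_algebraMap_eq fun x => (φ.commutes x).symm
  have : CharZero K' :=
    charZero_of_injective_ringHom ((algebraMap K K').comp (algebraMap F K)).injective
  obtain ⟨W', hW', hWW'⟩ := exists_flat_extension (M := M) W hW
  refine ⟨W', hW', fun P hP j hj g hg => ?_⟩
  have hcard : ((S j).equivFin ⟨g, hg⟩).1 < ℓ j := lt_of_lt_of_le (Fin.is_lt _) (hS j hj).1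
  have h1 := hf j ⟨_, hcard⟩ hj
  rw [dif_pos (show ((S j).equivFin ⟨g, hg⟩).1 < (S j).card from Fin.is_lt _), Fin.eta,
    Equiv.symm_apply_apply] at h1
  replace h1 : _ = g := h1
  rw [← h1, MvPolynomial.eval_map, ← MvPolynomial.aeval_def]
  have h2 := hWW' (MvPolynomial.map (algebraMap K K') (f j ⟨_, hcard⟩)) (fun Q hQ => by
    rw [MvPolynomial.eval_map, ← MvPolynomial.aeval_def]
    exact hWf Q hQ j hj _) P hP
  rwa [MvPolynomial.aeval_map_algebraMap] at h2

theorem canDetermineFlat_iff [CharZero F] {k d m n : ℕ} {ℓ : ℕ → ℕ} (hm : RD F d = m) :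
    CanDetermineFlat F k d ℓ n ↔
      ∀ (M : Type u) [Field M] [Algebra F M], IsRDClosed F m M → HasFlat M k d ℓ n :=
  ⟨fun h _ _ _ hM => h.hasFlat hm.le hM, canDetermineFlat_of_hasFlat hm⟩

theorem isSolution_smul {K K' : Type u} [Field K] [Field K'] [Algebra K K'] {n d : ℕ} {ℓ : ℕ → ℕ}
    {f : (j : ℕ) → Fin (ℓ j) → MvPolynomial (Fin n) K} (hf : IsSystem n d ℓ f) {P : Fin n → K'}
    (hP : IsSolution d f P) (c : K') : IsSolution d f (c • P) := fun j hj i => by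
  have h := eval_smul_of_isHomogeneous ((hf j hj i).map (algebraMap K K')) c P
  rw [MvPolynomial.eval_map, MvPolynomial.eval_map, ← MvPolynomial.aeval_def,
    ← MvPolynomial.aeval_def, hP j hj i, mul_zero] at h
  exact h

theorem canDetermineFlat_one_iff {d n : ℕ} {ℓ : ℕ → ℕ} :
    CanDetermineFlat F 1 d ℓ n ↔ CanDeterminePoint F d ℓ n := by
  constructor
  · intro h K _ _ hK f hf
    obtain ⟨K', i1, i2, hK', W, hW, hWf⟩ := h K hK f hf
    obtain ⟨P, hP, -⟩ := finrank_eq_one_iff'.1 hW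
    exact ⟨K', i1, i2, hK', P, fun h0 => hP (Subtype.ext h0), hWf P P.2⟩
  · intro h K _ _ hK f hf
    obtain ⟨K', i1, i2, hK', P, hP, hPf⟩ := h K hK f hf
    refine ⟨K', i1, i2, hK', Submodule.span K' {P}, finrank_span_singleton hP, fun Q hQ => ?_⟩
    obtain ⟨c, rfl⟩ := Submodule.mem_span_singleton.1 hQ
    exact isSolution_smul hf hPf c

theorem canDetermineFlat_two_iff {d n : ℕ} {ℓ : ℕ → ℕ} :
    CanDetermineFlat F 2 d ℓ n ↔ CanDetermineLine F d ℓ n := by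
  constructor
  · intro h K _ _ hK f hf
    obtain ⟨K', i1, i2, hK', W, hW, hWf⟩ := h K hK f hf
    let b := Module.finBasisOfFinrankEq K' W hW
    refine ⟨K', i1, i2, hK', b 0, b 1, ?_, fun x y => hWf _ (W.add_mem (W.smul_mem _ (b 0).2)
      (W.smul_mem _ (b 1).2))⟩
    have h1 := b.linearIndependent.map' W.subtype (Submodule.ker_subtype W)
    have e : W.subtype ∘ b = ![(b 0 : Fin n → K'), b 1] := by
      funext i
      fin_cases i <;> rfl
    rwa [e] at h1
  · intro h K _ _ hK f hf
    obtain ⟨K', i1, i2, hK', P₀, P₁, hli, hPf⟩ := h K hK f hf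
    refine ⟨K', i1, i2, hK', Submodule.span K' (Set.range ![P₀, P₁]),
      finrank_span_eq_card hli, fun Q hQ => ?_⟩
    rw [Matrix.range_cons, Matrix.range_cons, Matrix.range_empty, Set.union_empty,
      Set.singleton_union] at hQ
    obtain ⟨x, y, rfl⟩ := Submodule.mem_span_pair.1 hQ
    exact hPf x y

end CanDetermine

/-! ### The reduction to closed fields and the boundary cases. -/

section Formula

variable {F : Type u} [Field F]

theorem isRDClosed_of_isAlgClosed (m : ℕ) (M : Type u) [Field M] [Algebra F M] [IsAlgClosed M] :
    IsRDClosed F m M := fun _ _ p _ => IsAlgClosed.splits p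

variable [CharZero F] {d : ℕ} {ℓ : ℕ → ℕ}

/-- To obliterate the forms of degree `d` it suffices to do so over closed fields. -/
theorem CanDetermineFlat.obliterate {k n n' : ℕ} {ℓ ℓ' : ℕ → ℕ} (hd : 2 ≤ d)
    (hflat : ∀ (M : Type u) [Field M] [Infinite M],
      (∀ p : Polynomial M, p.natDegree ≤ d → p.Splits) → HasFlat M k (d - 1) ℓ' n → HasFlat M k d ℓ n')
    (h : CanDetermineFlat F k (d - 1) ℓ' n) : CanDetermineFlat F k d ℓ n' := by
  obtain ⟨m, hm⟩ := exists_RD_eq (F := F) (by omega : 1 ≤ d)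
  refine canDetermineFlat_of_hasFlat hm fun M _ _ hM => ?_
  have : CharZero M := charZero_of_injective_algebraMap (algebraMap F M).injective
  exact hflat M (hM.splits_of_natDegree_le hm.le hd) (h.hasFlat
    ((RD_mono (by omega) hd (by omega)).trans hm.le) hM)

theorem canDetermineFlat_add_linear_iff {k n m : ℕ} (hd : 1 ≤ d) :
    CanDetermineFlat F k d ℓ n ↔
      CanDetermineFlat F k d (Function.update ℓ 1 (ℓ 1 + m)) (n + m) := by
  obtain ⟨r, hr⟩ := exists_RD_eq (F := F) hd
  rw [canDetermineFlat_iff hr, canDetermineFlat_iff hr]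
  exact ⟨fun h M _ _ hM => (h M hM).add_linear hd m, fun h M _ _ hM => (h M hM).of_add_linear hd⟩

theorem not_canDetermineFlat_two_zero [IsAlgClosed F] (hd : 1 ≤ d) :
    ¬ CanDetermineFlat F 2 d ℓ 0 := by
  intro h
  obtain ⟨r, hr⟩ := exists_RD_eq (F := F) hd
  obtain ⟨W, hW, -⟩ := h.hasFlat hr.le (isRDClosed_of_isAlgClosed r F) (fun _ => ∅)
    fun j _ => by simp
  have := Submodule.finrank_le W
  rw [hW] at this
  simp at this

/-- In one variable a nonzero form of positive degree has only the trivial zero. This starts the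
threshold shift for the polar cone. -/
theorem not_canDetermineFlat_one_one [IsAlgClosed F] (hd : 1 ≤ d) (hℓ : 1 ≤ ℓ d) :
    ¬ CanDetermineFlat F 1 d (polarConeType d ℓ) 1 := by
  classical
  intro h
  obtain ⟨r, hr⟩ := exists_RD_eq (F := F) hd
  obtain ⟨W, hW, hWf⟩ := h.hasFlat hr.le (isRDClosed_of_isAlgClosed r F)
    (fun j => if j = d then {MvPolynomial.X 0 ^ d} else ∅) fun j hj => by
      split_ifs with hjd
      · subst hjd
        rw [polarConeType_top, Finset.card_singleton]
        refine ⟨hℓ, fun f hf => ?_⟩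
        rw [Finset.mem_singleton.1 hf]
        exact MvPolynomial.isHomogeneous_X_pow _ _
      · simp
  have hW0 : W = ⊥ := by
    refine (Submodule.eq_bot_iff W).2 fun P hP => ?_
    have := hWf P hP d (by simp [hd]) (MvPolynomial.X 0 ^ d) (by simp)
    rw [map_pow, MvPolynomial.eval_X] at this
    funext i
    rw [Subsingleton.elim i 0]
    exact eq_zero_of_pow_eq_zero this
  rw [hW0, finrank_bot] at hW
  exact zero_ne_one hW

/-- The leading term in degree `d - 1` is `ℓ d (ℓ d + 1) / 2`. -/
theorem oblitCount_pred_pos (hd : 2 ≤ d) (hℓ : 1 ≤ ℓ d) : 1 ≤ oblitCount d ℓ (d - 1) := by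
  have h : d - (d - 1) = 1 := by omega
  refine le_trans ?_ (Nat.le_add_right _ _)
  rw [h, Nat.add_sub_cancel, Nat.choose_one_right, one_mul]
  rw [Nat.le_div_iff_mul_le (by omega)]
  nlinarith

end Formula

end

end Obliteration

/-! ### The formula of obliteration. -/

theorem mainTheorem4 (F : Type u) [Field F] [IsAlgClosed F] [CharZero F]
    (d : ℕ) (hd : 2 ≤ d) (ℓ : ℕ → ℕ) (hℓ : 2 ≤ ℓ d) :
    (Obliteration.numVarsLinear F d ℓ ≤
        Obliteration.numVarsLinear F (d - 1) (Obliteration.oblitCount d ℓ) + (ℓ d : ℕ∞) ∧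
      Obliteration.numVarsLinear F (d - 1) (Obliteration.oblitCount d ℓ) + (ℓ d : ℕ∞) =
        Obliteration.numVarsLinear F (d - 1)
          (Function.update (Obliteration.oblitCount d ℓ) 1
            (Obliteration.oblitCount d ℓ 1 + ℓ d))) ∧
    (Obliteration.polarConeBound F d ℓ ≤
        Obliteration.polarConeBound F (d - 1) (Obliteration.oblitCount d ℓ) + (ℓ d : ℕ∞) ∧
      Obliteration.polarConeBound F (d - 1) (Obliteration.oblitCount d ℓ) + (ℓ d : ℕ∞) =
        Obliteration.polarConeBound F (d - 1)
          (Function.update (Obliteration.oblitCount d ℓ) 1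
            (Obliteration.oblitCount d ℓ 1 + ℓ d))) := by
  open Obliteration in
  have hd1 : 1 ≤ d - 1 := by omega
  -- The two types agree only in degrees at least `1`, so the comparison passes through closed
  -- fields, where only the counts in degrees `1, …, d - 1` enter.
  have hupd : ∀ n, CanDeterminePoint F (d - 1) (polarConeType (d - 1)
      (Function.update (oblitCount d ℓ) 1 (oblitCount d ℓ 1 + ℓ d))) n ↔
      CanDeterminePoint F (d - 1) (Function.update (polarConeType (d - 1) (oblitCount d ℓ)) 1
        (polarConeType (d - 1) (oblitCount d ℓ) 1 + ℓ d)) n := by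
    intro n
    obtain ⟨r, hr⟩ := exists_RD_eq (F := F) hd1
    rw [← canDetermineFlat_one_iff, ← canDetermineFlat_one_iff, canDetermineFlat_iff hr,
      canDetermineFlat_iff hr]
    have e : ∀ j ∈ Finset.Icc 1 (d - 1), polarConeType (d - 1)
        (Function.update (oblitCount d ℓ) 1 (oblitCount d ℓ 1 + ℓ d)) j =
        Function.update (polarConeType (d - 1) (oblitCount d ℓ)) 1
          (polarConeType (d - 1) (oblitCount d ℓ) 1 + ℓ d) j := fun j hj =>
      polarConeType_update (d - 1) (ℓ d) hd1 (oblitCount d ℓ) (Finset.mem_Icc.1 hj).1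
    exact ⟨fun h M _ _ hM => (h M hM).mono fun j hj => (e j hj).ge,
      fun h M _ _ hM => (h M hM).mono fun j hj => (e j hj).le⟩
  refine ⟨⟨?_, ?_⟩, ?_, ?_⟩
  · rw [numVarsLinear_eq_threshold, numVarsLinear_eq_threshold]
    refine threshold_le_add fun n hn => ?_
    rw [← canDetermineFlat_two_iff] at hn ⊢
    exact hn.obliterate hd fun M _ _ hM h => h.line_obliterate (by omega) hM
  · rw [numVarsLinear_eq_threshold, numVarsLinear_eq_threshold]
    refine threshold_add_eq (fun n => ?_) zero_le_one ?_
    · rw [← canDetermineFlat_two_iff, ← canDetermineFlat_two_iff]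
      exact canDetermineFlat_add_linear_iff hd1
    · rw [← canDetermineFlat_two_iff]
      exact not_canDetermineFlat_two_zero hd1
  · rw [polarConeBound, polarConeBound, add_right_comm]
    gcongr
    rw [minDimBound_eq_threshold, minDimBound_eq_threshold]
    refine threshold_le_add fun n hn => ?_
    rw [← canDetermineFlat_one_iff] at hn ⊢
    rw [add_right_comm]
    exact hn.obliterate hd fun M _ _ hM h => h.point_obliterate (by omega) hM
  · rw [polarConeBound, polarConeBound, add_right_comm]
    congr 1
    rw [minDimBound_eq_threshold, minDimBound_eq_threshold]
    refine threshold_add_eq (fun n => ?_) le_rfl ?_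
    · rw [hupd, ← canDetermineFlat_one_iff, ← canDetermineFlat_one_iff, add_right_comm]
      exact canDetermineFlat_add_linear_iff hd1
    · rw [← canDetermineFlat_one_iff]
      exact not_canDetermineFlat_one_one hd1 (oblitCount_pred_pos hd (by omega))
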